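/- Let $T$ be a self-adjoint operator in a complex Hilbert space $\mathcal H$, bounded from below and unbounded from above, let $m=\min\sigma(T)$, and let $\mathfrak t$ be the closed sesquilinear form associated with $T$, so that $\mathrm{Dom}(\mathfrak t)=\mathrm{Dom}(|T|^{1/2})$; put $\|\phi\|_{\mathfrak t}^2=(\mathfrak t-m)[\phi]+\|\phi\|^2$. Let $\mathcal L_n\subset\mathrm{Dom}(\mathfrak t)$ $(n\in\mathbb N)$ be finite-dimensional subspaces such that for every $\phi\in\mathrm{Dom}(\mathfrak t)$ there are $\phi_n\in\mathcal L_n$ with $\|\phi-\phi_n\|_{\mathfrak t}\to0$. Let $a<b$ be real numbers in the resolvent set $\rho(T)$, put $\Delta=[a,b]$, and assume that $\Delta\cap\sigma(T)=\{\lambda_1,\dots,\lambda_d\}$ consists of isolated eigenvalues of finite multiplicity. Let $\mathcal L(\{\lambda_j\})=\ker(T-\lambda_j)$, let $\mathcal L(\Delta)$ be the span of these eigenspaces, and let $$\delta_n=\delta_{\mathfrak t}(\mathcal L(\Delta),\mathcal L_n)=\sup_{x\in\mathcal L(\Delta),\ \|x\|_{\mathfrak t}=1}\ \inf_{y\in\mathcal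 L_n}\|x-y\|_{\mathfrak t}$$ (with $\delta_n=0$ if $\mathcal L(\Delta)=\{0\}$). Let $\gamma<m$ and $\gamma<a$. Let $Q_n$ be the orthogonal projection of $\mathcal H$ onto the span of the vectors $(T-\gamma)^{1/2}u$, where $u$ runs over the $u\in\mathcal L_n$ for which there is $\mu\in[a,b]$ with $\mathfrak t(u,v)=\mu\langle u,v\rangle$ for all $v\in\mathcal L_n$. For $\tau,r\ge0$ let $U_{\tau,r}$ be the set of all $z\in\mathbb C$ with $$\tfrac1{b-\gamma}\le\mathrm{Re}\,z\le\tfrac1{a-\gamma},\quad 0\le\mathrm{Im}\,z\le1,\quad \Big|z-\tfrac1{b-\gamma}\Big|\ge1+\tau,\quad\Big|z-\tfrac1{a-\gamma}\Big|\ge1+\tau,$$ and with $\big|z-(\tfrac1{\lambda_j-\gamma}+i)\big|\ge r$ and $z\ne\tfrac1{\lambda_j-\gamma}+i$ for $1\le j\le d$. Then there exist sequences $(\tau_n)$ and $(r_n)$ of non-negative reals, with $\tau_n=\mathcal O(\delta_n)$ and $r_n=\mathcal O(\delta_n^2)$ as $n\to\infty$, such that for all sufficiently large $n$ the following hold. 1.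 $U_{\tau_n,r_n}\setminus\mathbb R\subset\rho\big((T-\gamma)^{-1}+iQ_n\big)$. 2. For every $j$: if $\delta_n>0$, then $r_n>0$, the circle $\Gamma_j$ with center $\tfrac1{\lambda_j-\gamma}+i$ and radius $r_n$ is contained in $\rho\big((T-\gamma)^{-1}+iQ_n\big)$, and the spectral subspace (the range of the Riesz projection) associated with $(T-\gamma)^{-1}+iQ_n$ and the region enclosed by $\Gamma_j$ has the same dimension as $\mathcal L(\{\lambda_j\})$. If $\delta_n=0$ (so that $r_n=0$ is forced for large $n$), the same holds for every circle with center $\tfrac1{\lambda_j-\gamma}+i$ and sufficiently small positive radius. -/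

import Mathlib

open Filter Topology Asymptotics

noncomputable section

namespace Galerkin

variable {H : Type*} [NormedAddCommGroup H] [InnerProductSpace ℂ H]

/-! ### Unbounded operators: resolvent, spectrum, eigenspaces -/

/-- `R` is the bounded everywhere defined inverse of `T - z : Dom T → H`. -/
def IsResolventAt (T : H →ₗ.[ℂ] H) (z : ℂ) (R : H →L[ℂ] H) : Prop :=
  (∀ x : H, ∃ h : R x ∈ T.domain, T ⟨R x, h⟩ - z • R x = x) ∧
    ∀ x : T.domain, R (T x - z • (x : H)) = x

/-- The resolvent set `ρ(T)` of an unbounded operator. -/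
def resolventSetU (T : H →ₗ.[ℂ] H) : Set ℂ := {z | ∃ R : H →L[ℂ] H, IsResolventAt T z R}

/-- The spectrum `σ(T)` of an unbounded operator. -/
def spectrumU (T : H →ₗ.[ℂ] H) : Set ℂ := (resolventSetU T)ᶜ

open Classical in
/-- The bounded operator `(T - z)⁻¹`, for `z ∈ ρ(T)` (and `0` otherwise). -/
def resolventOp (T : H →ₗ.[ℂ] H) (z : ℂ) : H →L[ℂ] H :=
  if h : ∃ R : H →L[ℂ] H, IsResolventAt T z R then h.choose else 0

/-- The eigenspace `ker (T - z)`. -/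
def eigenspaceU (T : H →ₗ.[ℂ] H) (z : ℂ) : Submodule ℂ H :=
  (LinearMap.ker (T.toFun - z • T.domain.subtype)).map T.domain.subtype

/-- `z ∈ σ_dis(T)`: an isolated point of the spectrum which is an eigenvalue of finite
multiplicity. -/
def InDiscreteSpectrum (T : H →ₗ.[ℂ] H) (z : ℂ) : Prop :=
  z ∈ spectrumU T ∧ (∃ ε > 0, ∀ w ∈ spectrumU T, ‖w - z‖ < ε → w = z) ∧
    eigenspaceU T z ≠ ⊥ ∧ FiniteDimensional ℂ (eigenspaceU T z)

/-- `L(Δ)` for `Δ = [a, b]`: the span of the eigenvectors of `T` with eigenvalues in `[a, b]`. It is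
the range of the spectral projection `E(Δ)` if `Δ ∩ σ(T)` consists of discrete eigenvalues. -/
def eigenspaceIcc (T : H →ₗ.[ℂ] H) (a b : ℝ) : Submodule ℂ H :=
  ⨆ l ∈ Set.Icc a b, eigenspaceU T (l : ℂ)

/-- `T` is bounded from below. -/
def BoundedFromBelow (T : H →ₗ.[ℂ] H) : Prop :=
  ∃ c : ℝ, ∀ x : T.domain, c * ‖(x : H)‖ ^ 2 ≤ (inner ℂ (x : H) (T x)).re

/-- `T` is bounded from above. -/
def BoundedFromAbove (T : H →ₗ.[ℂ] H) : Prop :=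
  ∃ c : ℝ, ∀ x : T.domain, (inner ℂ (x : H) (T x)).re ≤ c * ‖(x : H)‖ ^ 2

/-! ### Square roots and the closed quadratic form -/

/-- The square root `(T - c)^{1/2}` of `T - c`, for a self-adjoint `T` and a real `c < min σ(T)`:
the (unbounded) inverse of the nonnegative square root of the bounded, nonnegative and injective
operator `(T - c)⁻¹`. -/
def sqrtShift [CompleteSpace H] (T : H →ₗ.[ℂ] H) (c : ℝ) : H →ₗ.[ℂ] H :=
  ((CFC.sqrt (resolventOp T (c : ℂ))).toLinearMap.toPMap ⊤).inverse

/-- The form domain `Dom(𝔱) = Dom(|T|^{1/2}) = Dom((T - m + 1)^{1/2})`, where `m = min σ(T)`. -/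
def formDomain [CompleteSpace H] (T : H →ₗ.[ℂ] H) (m : ℝ) : Submodule ℂ H :=
  (sqrtShift T (m - 1)).domain

/-- The closed sesquilinear form `𝔱` associated with `T`, where `m = min σ(T)`:
`(𝔱 - (m - 1))(x, y) = ⟨(T - m + 1)^{1/2} x, (T - m + 1)^{1/2} y⟩`.
As usual for forms, `𝔱(x, y)` is linear in `x` and antilinear in `y`. -/
def form [CompleteSpace H] (T : H →ₗ.[ℂ] H) (m : ℝ) (x y : formDomain T m) : ℂ :=
  inner ℂ (sqrtShift T (m - 1) y) (sqrtShift T (m - 1) x)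
    + ((m - 1 : ℝ) : ℂ) * inner ℂ (y : H) (x : H)

/-- The form norm `‖x‖_𝔱 = ((𝔱 - m)[x] + ‖x‖²)^{1/2}`. -/
def formNorm [CompleteSpace H] (T : H →ₗ.[ℂ] H) (m : ℝ) (x : formDomain T m) : ℝ :=
  √((form T m x x).re - m * ‖(x : H)‖ ^ 2 + ‖(x : H)‖ ^ 2)

/-- The distance from `x` to `M` in the form norm (for `M ⊆ Dom(𝔱)`). -/
def formDist [CompleteSpace H] (T : H →ₗ.[ℂ] H) (m : ℝ) (x : formDomain T m)
    (M : Submodule ℂ H) : ℝ :=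
  ⨅ y : {y : formDomain T m // (y : H) ∈ M}, formNorm T m (x - y.1)

/-- The gap `δ_𝔱(N, M) = sup {dist_𝔱(x, M) | x ∈ N, ‖x‖_𝔱 = 1}` (for `N, M ⊆ Dom(𝔱)`); it is `0`
for `N = 0`. The distances lie in `[0, 1]`, so the supremum is a genuine one. -/
def formGap [CompleteSpace H] (T : H →ₗ.[ℂ] H) (m : ℝ) (N M : Submodule ℂ H) : ℝ :=
  ⨆ x : {x : formDomain T m // (x : H) ∈ N ∧ formNorm T m x = 1}, formDist T m x.1 M

/-! ### Galerkin eigenvectors and the projections `Q_n` -/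

/-- The span of the Galerkin eigenvectors of `T` on the trial space `L` with eigenvalues in
`[a, b]`, that is, of the `u ∈ L` with `𝔱(u, v) = μ ⟨u, v⟩` for all `v ∈ L` and some
`μ ∈ [a, b]`. -/
def galerkinSpan [CompleteSpace H] (T : H →ₗ.[ℂ] H) (m a b : ℝ) (L : Submodule ℂ H) :
    Submodule ℂ H :=
  Submodule.span ℂ {w : H | ∃ u : formDomain T m, (u : H) = w ∧ (u : H) ∈ L ∧
    ∃ μ ∈ Set.Icc a b, ∀ v : formDomain T m, (v : H) ∈ L →
      form T m u v = (μ : ℂ) * inner ℂ (v : H) (u : H)}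

/-- The image `R M` of a subspace `M` (contained in `Dom R`) under an unbounded operator `R`. -/
def imageU (R : H →ₗ.[ℂ] H) (M : Submodule ℂ H) : Submodule ℂ H :=
  (M.comap R.domain.subtype).map R.toFun

/-- The span of the vectors `(T - γ)^{1/2} u`, with `u` a Galerkin eigenvector of `T` on `L` for an
eigenvalue in `[a, b]`. -/
def transformedSpan [CompleteSpace H] (T : H →ₗ.[ℂ] H) (m γ a b : ℝ) (L : Submodule ℂ H) :
    Submodule ℂ H :=
  imageU (sqrtShift T γ) (galerkinSpan T m a b L)

instance finiteDimensional_galerkinSpan [CompleteSpace H] (T : H →ₗ.[ℂ] H) (m a b : ℝ) (L : Submodule ℂ H)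
    [FiniteDimensional ℂ L] : FiniteDimensional ℂ (galerkinSpan T m a b L) := by
  refine Submodule.finiteDimensional_of_le (S₂ := L) (Submodule.span_le.2 ?_)
  rintro w ⟨u, rfl, hu, -⟩
  exact hu

instance finiteDimensional_transformedSpan [CompleteSpace H] (T : H →ₗ.[ℂ] H) (m γ a b : ℝ) (L : Submodule ℂ H)
    [FiniteDimensional ℂ L] : FiniteDimensional ℂ (transformedSpan T m γ a b L) := by
  have h : FiniteDimensional ℂ
      ((galerkinSpan T m a b L).comap (sqrtShift T γ).domain.subtype) :=
    FiniteDimensional.of_injective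
      (((sqrtShift T γ).domain.subtype).restrict
        (p := (galerkinSpan T m a b L).comap (sqrtShift T γ).domain.subtype)
        (q := galerkinSpan T m a b L) (fun _ hx => hx))
      (fun x y hxy => Subtype.ext (Subtype.ext
        (congrArg (fun t : galerkinSpan T m a b L => (t : H)) hxy)))
  unfold transformedSpan imageU
  infer_instance

/-- The orthogonal projection `Q` onto the span of the vectors `(T - γ)^{1/2} u`, with `u` a
Galerkin eigenvector of `T` on `L` for an eigenvalue in `[a, b]`. -/
def galerkinProj [CompleteSpace H] (T : H →ₗ.[ℂ] H) (m γ a b : ℝ) (L : Submodule ℂ H)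
    [FiniteDimensional ℂ L] : H →L[ℂ] H :=
  (transformedSpan T m γ a b L).starProjection

/-! ### Regions and spectral subspaces in the complex plane -/

/-- `U_{τ,r}(p, q)`: the points of the rectangle `p ≤ Re z ≤ q`, `0 ≤ Im z ≤ 1` that are exterior
to the circles with centers `p`, `q` and radius `1 + τ` and to the circles with centers `l + i`
and radius `r`, for `l ∈ Λ`. For `r > 0` it is closed; if `r = 0`, then only the centers `l + i`
themselves are removed. -/
def regionU (p q τ r : ℝ) (Λ : Set ℝ) : Set ℂ :=
  {z | p ≤ z.re ∧ z.re ≤ q ∧ 0 ≤ z.im ∧ z.im ≤ 1 ∧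
    1 + τ ≤ ‖z - (p : ℂ)‖ ∧ 1 + τ ≤ ‖z - (q : ℂ)‖ ∧
    ∀ l ∈ Λ, r ≤ ‖z - ((l : ℂ) + Complex.I)‖ ∧ z ≠ (l : ℂ) + Complex.I}

/-- The spectral (Riesz) projection `(2πi)⁻¹ ∮ (z - B)⁻¹ dz` of a bounded operator `B` for the
region enclosed by the circle with center `c` and radius `s`. -/
def rieszProjection (B : H →L[ℂ] H) (c : ℂ) (s : ℝ) : H →L[ℂ] H :=
  (2 * (Real.pi : ℂ) * Complex.I)⁻¹ • ∮ z in C(c, s), resolvent B z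

/-- The spectral subspace of a bounded operator `B` for the region enclosed by the circle with
center `c` and radius `s`. -/
def spectralSubspace (B : H →L[ℂ] H) (c : ℂ) (s : ℝ) : Submodule ℂ H :=
  LinearMap.range (rieszProjection B c s).toLinearMap

/-- The circle with center `c` and radius `s` lies in the resolvent set of `B`, and the spectral
subspace of `B` for the region it encloses has the same dimension as `M`. -/
def CircleEncloses (B : H →L[ℂ] H) (c : ℂ) (s : ℝ) (M : Submodule ℂ H) : Prop :=
  Metric.sphere c s ⊆ resolventSet ℂ B ∧
    Module.rank ℂ (spectralSubspace B c s) = Module.rank ℂ M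

end Galerkin

end

/-!
The operator `A = (T - γ)⁻¹` is bounded, self-adjoint and nonnegative, and the form norm is
equivalent to the norm of `(T - γ)^{1/2} u` (`exists_sqrtResolvent_eq_mul`). The map
`u ↦ (T - γ)^{1/2} u` therefore turns the Galerkin method for `T` into the compression of `A` to the
subspaces `(T - γ)^{1/2} Lₙ`, with Galerkin eigenvalues in `[a, b]` corresponding to eigenvalues of
the compression in `[1/(b - γ), 1/(a - γ)]`. Let `E` be the spectral projection of `A` for this
interval, and `F = 1 - E`. A residual estimate in an eigenbasis of the compression
(`norm_sub_starProjection_le_of_eigenvector`) gives `‖(1 - Qₙ) E‖ ≤ C δₙ`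
(`exists_norm_one_sub_galerkinProj_mul_le`). Nothing else about `Qₙ` is needed; in particular it
does not matter how `Qₙ` acts on the range of `F`, where spectral pollution may occur.

With respect to `E` and `F` the operator `A + i Qₙ` has the diagonal blocks `A + i + O(δₙ²)` and
`F (A + i Qₙ) F`, and off-diagonal blocks of order `δₙ`. The spectrum of `A` on the range of `F` stays
away from the end points of the interval, so a point `z` of the region with parameter `τ = 0` has
distance at least some `κ > 1` from it; as `‖Qₙ‖ ≤ 1`, a Neumann series inverts the outer block with
a uniform bound. Hence `τₙ = 0` is admissible. Conjugation by `E + √r F` balances the off-diagonal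
blocks: the perturbation is then small relative to the resolvent of the block diagonal model as soon
as `δₙ² / r` is small and `z` has distance at least `r` from the points `1/(λⱼ - γ) + i`
(`norm_offDiag_mul_le`, `resolvent_conj_add_I_smul`). This gives the resolvent set with
`rₙ = const · δₙ²`. On a circle of radius `r` the same estimate shows that the Riesz projection of the
conjugated operator is at distance less than one from that of the model, which is the spectral
projection of `A` for `1/(λⱼ - γ)` (`rieszProjection_blockOp`). Both are idempotent
(`rieszProjection_mul_self`), so they have the same rank.
-/


/-! ### Riesz projections -/

theorem ContinuousLinearMap.map_circleIntegral {V W : Type*} [NormedAddCommGroup V]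
    [NormedSpace ℂ V] [CompleteSpace V] [NormedAddCommGroup W] [NormedSpace ℂ W] [CompleteSpace W]
    (Φ : V →L[ℂ] W) {f : ℂ → V} {c : ℂ} {s : ℝ} (hf : CircleIntegrable f c s) :
    Φ (∮ z in C(c, s), f z) = ∮ z in C(c, s), Φ (f z) := by
  unfold circleIntegral
  rw [← Φ.intervalIntegral_comp_comm hf.out]
  simp

namespace Galerkin

variable {H : Type*} [NormedAddCommGroup H] [InnerProductSpace ℂ H]

theorem resolvent_mul_sub {B : H →L[ℂ] H} {z : ℂ} (hz : z ∈ resolventSet ℂ B) :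
    resolvent B z * (algebraMap ℂ _ z - B) = 1 :=
  Ring.inverse_mul_cancel _ hz

theorem sub_mul_resolvent {B : H →L[ℂ] H} {z : ℂ} (hz : z ∈ resolventSet ℂ B) :
    (algebraMap ℂ _ z - B) * resolvent B z = 1 :=
  Ring.mul_inverse_cancel _ hz

theorem resolvent_eq_of_mul_eq_one {B G : H →L[ℂ] H} {z : ℂ}
    (h1 : G * (algebraMap ℂ _ z - B) = 1) (h2 : (algebraMap ℂ _ z - B) * G = 1) :
    z ∈ resolventSet ℂ B ∧ resolvent B z = G := by
  have hz : z ∈ resolventSet ℂ B := ⟨⟨_, G, h2, h1⟩, rfl⟩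
  refine ⟨hz, ?_⟩
  calc resolvent B z = resolvent B z * ((algebraMap ℂ _ z - B) * G) := by rw [h2, mul_one]
    _ = G := by rw [← mul_assoc, resolvent_mul_sub hz, one_mul]

theorem resolvent_mul_resolvent {B : H →L[ℂ] H} {z w : ℂ} (hz : z ∈ resolventSet ℂ B)
    (hw : w ∈ resolventSet ℂ B) (hzw : z ≠ w) :
    resolvent B z * resolvent B w = (w - z)⁻¹ • (resolvent B z - resolvent B w) := by
  have h : resolvent B z - resolvent B w = (w - z) • (resolvent B z * resolvent B w) := by
    calc resolvent B z - resolvent B w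
        = resolvent B z * ((algebraMap ℂ _ w - B) * resolvent B w)
          - (resolvent B z * (algebraMap ℂ _ z - B)) * resolvent B w := by
          rw [sub_mul_resolvent hw, resolvent_mul_sub hz, mul_one, one_mul]
      _ = resolvent B z * (algebraMap ℂ _ w - algebraMap ℂ _ z) * resolvent B w := by noncomm_ring
      _ = (w - z) • (resolvent B z * resolvent B w) := by
          rw [← map_sub, Algebra.algebraMap_eq_smul_one]; simp
  rw [h, smul_smul, inv_mul_cancel₀ (sub_ne_zero.2 hzw.symm), one_smul]

/-- If `P` and `E` are idempotents with `‖P - E‖ < 1`, then `E` is injective on the range of `P`. -/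
theorem rank_range_le_of_norm_sub_lt_one {P E : H →L[ℂ] H} (hP : P * P = P) (h : ‖P - E‖ < 1) :
    Module.rank ℂ (LinearMap.range P.toLinearMap) ≤ Module.rank ℂ (LinearMap.range E.toLinearMap) := by
  let φ : LinearMap.range P.toLinearMap →ₗ[ℂ] LinearMap.range E.toLinearMap :=
    (E.toLinearMap.domRestrict _).codRestrict _ fun x => ⟨x, rfl⟩
  refine LinearMap.rank_le_of_injective φ ((injective_iff_map_eq_zero φ).2 ?_)
  rintro ⟨x, y, rfl⟩ hx
  have hx' : E (P y) = 0 := congrArg Subtype.val hx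
  have hPP : P (P y) = P y := congrArg (fun S : H →L[ℂ] H => S y) hP
  have h1 : ‖P y‖ ≤ ‖P - E‖ * ‖P y‖ := by
    calc ‖P y‖ = ‖(P - E) (P y)‖ := by simp [hPP, hx']
      _ ≤ _ := (P - E).le_opNorm _
  have h2 : P y = 0 := by
    by_contra hne
    have := norm_pos_iff.2 hne
    nlinarith
  exact Subtype.ext h2

theorem rank_range_eq_of_norm_sub_lt_one {P E : H →L[ℂ] H} (hP : P * P = P) (hE : E * E = E)
    (h : ‖P - E‖ < 1) :
    Module.rank ℂ (LinearMap.range P.toLinearMap) = Module.rank ℂ (LinearMap.range E.toLinearMap) :=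
  (rank_range_le_of_norm_sub_lt_one hP h).antisymm
    (rank_range_le_of_norm_sub_lt_one hE (by rwa [norm_sub_rev]))

/-- Similar operators have the same resolvent set, and similar resolvents. -/
theorem resolvent_conj {B S S' : H →L[ℂ] H} (h1 : S * S' = 1) (h2 : S' * S = 1) {z : ℂ}
    (hz : z ∈ resolventSet ℂ (S * B * S')) :
    z ∈ resolventSet ℂ B ∧ resolvent B z = S' * resolvent (S * B * S') z * S := by
  have e : algebraMap ℂ (H →L[ℂ] H) z - S * B * S' = S * (algebraMap ℂ _ z - B) * S' := by
    rw [mul_sub, sub_mul, ← Algebra.commutes, mul_assoc (algebraMap ℂ _ z), h1, mul_one]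
  have e' : algebraMap ℂ (H →L[ℂ] H) z - B = S' * (algebraMap ℂ _ z - S * B * S') * S := by
    rw [e]
    calc _ = 1 * (algebraMap ℂ (H →L[ℂ] H) z - B) * 1 := by simp
      _ = (S' * S) * (algebraMap ℂ _ z - B) * (S' * S) := by rw [h2]
      _ = _ := by noncomm_ring
  refine resolvent_eq_of_mul_eq_one ?_ ?_
  · rw [e']
    calc _ = S' * (resolvent (S * B * S') z * ((S * S') *
            (algebraMap ℂ (H →L[ℂ] H) z - S * B * S'))) * S := by noncomm_ring
      _ = 1 := by rw [h1, one_mul, resolvent_mul_sub hz, mul_one, h2]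
  · rw [e']
    calc _ = S' * ((algebraMap ℂ (H →L[ℂ] H) z - S * B * S') * ((S * S') *
            resolvent (S * B * S') z)) * S := by noncomm_ring
      _ = 1 := by rw [h1, one_mul, sub_mul_resolvent hz, mul_one, h2]

variable [CompleteSpace H]

theorem differentiableOn_resolvent (B : H →L[ℂ] H) :
    DifferentiableOn ℂ (resolvent B) (resolventSet ℂ B) := fun _ hz =>
  (spectrum.hasDerivAt_resolvent_const_left hz).differentiableAt.differentiableWithinAt

theorem continuousOn_resolvent_sphere {B : H →L[ℂ] H} {c : ℂ} {s : ℝ}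
    (h : Metric.sphere c s ⊆ resolventSet ℂ B) : ContinuousOn (resolvent B) (Metric.sphere c s) :=
  (differentiableOn_resolvent B).continuousOn.mono h

theorem circleIntegrable_resolvent {B : H →L[ℂ] H} {c : ℂ} {s : ℝ} (hs : 0 ≤ s)
    (h : Metric.sphere c s ⊆ resolventSet ℂ B) : CircleIntegrable (resolvent B) c s :=
  (continuousOn_resolvent_sphere h).circleIntegrable hs

/-- The resolvent set is open, so it contains an annulus around any circle that it contains. -/
theorem exists_annulus_subset_resolventSet {B : H →L[ℂ] H} {c : ℂ} {s : ℝ} (hs : 0 < s)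
    (h : Metric.sphere c s ⊆ resolventSet ℂ B) :
    ∃ s' > s, ∀ z, s ≤ ‖z - c‖ → ‖z - c‖ ≤ s' → z ∈ resolventSet ℂ B := by
  obtain ⟨δ, hδ, hsub⟩ := (isCompact_sphere c s).exists_cthickening_subset_open
    (spectrum.isOpen_resolventSet (𝕜 := ℂ) B) h
  refine ⟨s + δ, by linarith, fun z h1 h2 => hsub ?_⟩
  have hz : 0 < ‖z - c‖ := hs.trans_le h1
  -- the radial projection of `z` to the circle is at distance `‖z - c‖ - s` from `z`
  have hz' : (‖z - c‖ : ℂ) ≠ 0 := by exact_mod_cast hz.ne'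
  refine Metric.mem_cthickening_of_dist_le z (c + ((s / ‖z - c‖ : ℝ) : ℂ) * (z - c)) δ _ ?_ ?_
  · rw [mem_sphere_iff_norm, add_sub_cancel_left, norm_mul, Complex.norm_real, Real.norm_eq_abs,
      abs_of_nonneg (by positivity), div_mul_cancel₀ _ hz.ne']
  · rw [dist_eq_norm, show z - (c + ((s / ‖z - c‖ : ℝ) : ℂ) * (z - c))
      = ((1 - s / ‖z - c‖ : ℝ) : ℂ) * (z - c) by push_cast; ring, norm_mul, Complex.norm_real,
      Real.norm_eq_abs, abs_of_nonneg (by rw [sub_nonneg, div_le_one hz]; exact h1), sub_mul,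
      div_mul_cancel₀ _ hz.ne', one_mul]
    linarith

theorem rieszProjection_eq_of_annulus {B : H →L[ℂ] H} {c : ℂ} {s s' : ℝ} (hs : 0 < s)
    (hss : s ≤ s') (h : ∀ z, s ≤ ‖z - c‖ → ‖z - c‖ ≤ s' → z ∈ resolventSet ℂ B) :
    rieszProjection B c s' = rieszProjection B c s := by
  unfold rieszProjection
  congr 1
  have hd : ∀ z ∈ Metric.closedBall c s' \ Metric.ball c s, z ∈ resolventSet ℂ B := by
    rintro z ⟨h1, h2⟩
    rw [mem_closedBall_iff_norm] at h1
    rw [mem_ball_iff_norm, not_lt] at h2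
    exact h z h2 h1
  refine Complex.circleIntegral_eq_of_differentiable_on_annulus_off_countable hs hss
    Set.countable_empty (fun z hz => ?_) (fun z hz => ?_)
  · exact ((differentiableOn_resolvent B).continuousOn z (hd z hz)).mono hd
  · refine (spectrum.hasDerivAt_resolvent_const_left (hd z ⟨?_, ?_⟩)).differentiableAt
    · exact Metric.ball_subset_closedBall hz.1.1
    · exact fun hz' => hz.1.2 (Metric.ball_subset_closedBall hz')

/-- By the resolvent identity, the product of the projections for two nearby radii is a sum of two
contour integrals; one of them is evaluated by `∮ (w - z)⁻¹ dw = 2πi`, the other vanishes because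
a Cauchy integral is analytic inside its circle. -/
theorem rieszProjection_mul_self {B : H →L[ℂ] H} {c : ℂ} {s : ℝ} (hs : 0 < s)
    (h : Metric.sphere c s ⊆ resolventSet ℂ B) :
    rieszProjection B c s * rieszProjection B c s = rieszProjection B c s := by
  obtain ⟨s', hss, hann⟩ := exists_annulus_subset_resolventSet hs h
  have hs' : 0 < s' := hs.trans hss
  have h' : Metric.sphere c s' ⊆ resolventSet ℂ B := fun z hz => by
    rw [mem_sphere_iff_norm] at hz
    exact hann z (by linarith) hz.le
  have hi := circleIntegrable_resolvent hs.le h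
  have hi' := circleIntegrable_resolvent hs'.le h'
  set k : ℂ := 2 * (Real.pi : ℂ) * Complex.I with hk
  have hk0 : k ≠ 0 := by simp [hk, Real.pi_ne_zero]
  let g : ℂ → (H →L[ℂ] H) := fun z => k⁻¹ • ∮ w in C(c, s'), (w - z)⁻¹ • resolvent B w
  have hg : DifferentiableOn ℂ g (Metric.ball c s') := by
    have := (hasFPowerSeriesOn_cauchy_integral (f := resolvent B) (c := c) (R := ⟨s', hs'.le⟩) hi'
      hs').differentiableOn
    rw [Metric.eball_coe (ε := ⟨s', hs'.le⟩)] at this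
    exact this
  have hg0 : ∮ z in C(c, s), g z = 0 :=
    (DifferentiableOn.diffContOnCl (s := Metric.ball c s) (hg.mono (by
      rw [closure_ball c hs.ne']; exact Metric.closedBall_subset_ball hss))).circleIntegral_eq_zero
      hs.le
  have key : ∀ z ∈ Metric.sphere c s,
      resolvent B z * rieszProjection B c s' = resolvent B z - g z := by
    intro z hz
    have hzb : z ∈ Metric.ball c s' := by
      rw [mem_sphere_iff_norm] at hz; rw [mem_ball_iff_norm]; linarith
    have hne : ∀ w ∈ Metric.sphere c s', z ≠ w := by
      rintro w hw rfl
      rw [mem_sphere_iff_norm] at hz hw; linarith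
    have hcont : ContinuousOn (fun w => (w - z)⁻¹) (Metric.sphere c s') :=
      (continuousOn_id.sub continuousOn_const).inv₀ fun w hw => sub_ne_zero.2 (hne w hw).symm
    have e1 : resolvent B z * (∮ w in C(c, s'), resolvent B w)
        = ∮ w in C(c, s'), resolvent B z * resolvent B w :=
      (ContinuousLinearMap.mul ℂ (H →L[ℂ] H) (resolvent B z)).map_circleIntegral hi'
    have e2 : (∮ w in C(c, s'), resolvent B z * resolvent B w)
        = ∮ w in C(c, s'), ((w - z)⁻¹ • resolvent B z - (w - z)⁻¹ • resolvent B w) :=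
      circleIntegral.integral_congr hs'.le fun w hw => by
        rw [resolvent_mul_resolvent (h hz) (h' hw) (hne w hw), smul_sub]
    have e3 : (∮ w in C(c, s'), ((w - z)⁻¹ • resolvent B z - (w - z)⁻¹ • resolvent B w))
        = (∮ w in C(c, s'), (w - z)⁻¹ • resolvent B z)
          - ∮ w in C(c, s'), (w - z)⁻¹ • resolvent B w :=
      circleIntegral.integral_sub
        ((hcont.smul continuousOn_const).circleIntegrable hs'.le)
        ((hcont.smul (continuousOn_resolvent_sphere h')).circleIntegrable hs'.le)
    rw [rieszProjection, mul_smul_comm, e1, e2, e3, circleIntegral.integral_smul_const,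
      circleIntegral.integral_sub_inv_of_mem_ball hzb, smul_sub, smul_smul,
      inv_mul_cancel₀ hk0, one_smul]
  have e4 : (∮ z in C(c, s), resolvent B z) * rieszProjection B c s'
      = ∮ z in C(c, s), resolvent B z * rieszProjection B c s' :=
    ((ContinuousLinearMap.mul ℂ (H →L[ℂ] H)).flip (rieszProjection B c s')).map_circleIntegral hi
  calc rieszProjection B c s * rieszProjection B c s
      = rieszProjection B c s * rieszProjection B c s' := by
        rw [rieszProjection_eq_of_annulus hs hss.le hann]
    _ = k⁻¹ • ∮ z in C(c, s), (resolvent B z - g z) := by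
        rw [← circleIntegral.integral_congr hs.le key, ← e4, ← smul_mul_assoc]; rfl
    _ = rieszProjection B c s := by
        rw [circleIntegral.integral_sub hi ((hg.continuousOn.mono
          fun z hz => Metric.closedBall_subset_ball hss
            (Metric.sphere_subset_closedBall hz)).circleIntegrable hs.le), hg0, sub_zero]
        rfl

/-- The dimension of the spectral subspace is invariant under similarity. -/
theorem rank_spectralSubspace_conj {B S S' : H →L[ℂ] H} (h1 : S * S' = 1) (h2 : S' * S = 1) {c : ℂ}
    {s : ℝ} (hs : 0 ≤ s) (h : Metric.sphere c s ⊆ resolventSet ℂ (S * B * S')) :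
    Module.rank ℂ (spectralSubspace B c s) = Module.rank ℂ (spectralSubspace (S * B * S') c s) := by
  have e : rieszProjection B c s = S' * rieszProjection (S * B * S') c s * S := by
    have hΦ := (((ContinuousLinearMap.mul ℂ (H →L[ℂ] H)).flip S).comp
      (ContinuousLinearMap.mul ℂ (H →L[ℂ] H) S')).map_circleIntegral
      (circleIntegrable_resolvent hs h)
    simp only [ContinuousLinearMap.comp_apply, ContinuousLinearMap.flip_apply,
      ContinuousLinearMap.mul_apply'] at hΦ
    rw [rieszProjection, rieszProjection, mul_smul_comm, smul_mul_assoc, hΦ]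
    exact congrArg _ (circleIntegral.integral_congr hs fun z hz => (resolvent_conj h1 h2 (h hz)).2)
  have h2' : ∀ x, S' (S x) = x := fun x => congrArg (fun A : H →L[ℂ] H => A x) h2
  have h1' : ∀ x, S (S' x) = x := fun x => congrArg (fun A : H →L[ℂ] H => A x) h1
  let Θ : H ≃ₗ[ℂ] H :=
    { S.toLinearMap with invFun := S', left_inv := h2', right_inv := h1' }
  have hmap : spectralSubspace (S * B * S') c s = (spectralSubspace B c s).map Θ.toLinearMap := by
    ext x
    constructor
    · rintro ⟨y, rfl⟩
      refine ⟨rieszProjection B c s (S' y), ⟨_, rfl⟩, ?_⟩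
      rw [e]
      change S (S' (rieszProjection (S * B * S') c s (S (S' y)))) = _
      rw [h1', h1']; rfl
    · rintro ⟨_, ⟨y, rfl⟩, rfl⟩
      refine ⟨S y, ?_⟩
      change _ = S (rieszProjection B c s y)
      rw [e]
      change _ = S (S' (rieszProjection (S * B * S') c s (S y)))
      rw [h1']; rfl
  rw [hmap]
  exact (Θ.submoduleMap (spectralSubspace B c s)).rank_eq

end Galerkin

/-! ### Functional calculus near isolated spectral points -/

namespace Galerkin

variable {H : Type*} [NormedAddCommGroup H] [InnerProductSpace ℂ H]

/-- Modifying a continuous function at finitely many isolated points of `σ` does not affect its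
continuity on `σ`. -/
theorem continuousOn_of_isolated {σ s : Set ℂ} (hs : s.Finite)
    (hiso : ∀ t ∈ s, ∀ᶠ w in 𝓝 t, w ∈ σ → w = t) {f : ℂ → ℂ} (g : ℂ → ℂ)
    (hfg : ∀ t, t ∉ s → f t = g t) (hg : ∀ t ∈ σ, t ∉ s → ContinuousAt g t) :
    ContinuousOn f σ := by
  intro t ht
  by_cases hts : t ∈ s
  · have h : ∀ᶠ w in 𝓝[σ] t, f w = f t := by
      rw [eventually_nhdsWithin_iff]
      filter_upwards [hiso t hts] with w hw hwσ
      rw [hw hwσ]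
    exact Tendsto.congr' (h.mono fun w hw => hw.symm) tendsto_const_nhds
  · have h : ∀ᶠ w in 𝓝 t, g w = f w :=
      Filter.Eventually.mono (hs.isClosed.isOpen_compl.mem_nhds hts) fun w hw => (hfg w hw).symm
    exact ((hg t ht hts).congr h).continuousWithinAt

theorem continuousOn_indicator {A : H →L[ℂ] H} {s : Set ℂ} (hs : s.Finite)
    (hiso : ∀ t ∈ s, ∀ᶠ w in 𝓝 t, w ∈ spectrum ℂ A → w = t) {s' : Set ℂ} (h' : s' ⊆ s) :
    ContinuousOn (fun t => open Classical in if t ∈ s' then (1 : ℂ) else 0) (spectrum ℂ A) :=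
  continuousOn_of_isolated hs hiso (fun _ => 0) (fun _ ht => if_neg fun h => ht (h' h))
    fun _ _ _ => continuousAt_const

variable [CompleteSpace H]

open Classical in
/-- The spectral projection of the normal operator `A` for a set `s` of isolated points of the
spectrum, as a function of `A`. -/
noncomputable def specProj (A : H →L[ℂ] H) (s : Set ℂ) : H →L[ℂ] H := cfc (fun t => if t ∈ s then (1 : ℂ) else 0) A

section

variable {A : H →L[ℂ] H} {s : Set ℂ}

theorem isSelfAdjoint_specProj (A : H →L[ℂ] H) (s : Set ℂ) : IsSelfAdjoint (specProj A s) := by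
  rw [IsSelfAdjoint, specProj, ← cfc_star]
  exact cfc_congr fun t _ => by split_ifs <;> simp

theorem specProj_mul_self (hs : s.Finite)
    (hiso : ∀ t ∈ s, ∀ᶠ w in 𝓝 t, w ∈ spectrum ℂ A → w = t) :
    specProj A s * specProj A s = specProj A s := by
  have hc := continuousOn_indicator hs hiso subset_rfl
  rw [specProj, ← cfc_mul _ _ A hc hc]
  exact cfc_congr fun t _ => by simp

theorem norm_specProj_le (A : H →L[ℂ] H) (s : Set ℂ) : ‖specProj A s‖ ≤ 1 :=
  norm_cfc_le zero_le_one fun t _ => by split_ifs <;> simp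

theorem one_sub_specProj (hA : IsStarNormal A) (hs : s.Finite)
    (hiso : ∀ t ∈ s, ∀ᶠ w in 𝓝 t, w ∈ spectrum ℂ A → w = t) :
    1 - specProj A s = cfc (fun t => open Classical in if t ∈ s then (0 : ℂ) else 1) A := by
  have hc := continuousOn_indicator hs hiso subset_rfl
  rw [specProj, ← cfc_const_one ℂ A, ← cfc_sub (fun _ => 1) _ A continuousOn_const hc]
  exact cfc_congr fun t _ => by split_ifs <;> simp_all

theorem norm_one_sub_specProj_le (hA : IsStarNormal A) (hs : s.Finite)
    (hiso : ∀ t ∈ s, ∀ᶠ w in 𝓝 t, w ∈ spectrum ℂ A → w = t) : ‖1 - specProj A s‖ ≤ 1 := by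
  rw [one_sub_specProj hA hs hiso]
  exact norm_cfc_le zero_le_one fun t _ => by split_ifs <;> simp

/-- The range of the spectral projection for an isolated point is the eigenspace. -/
theorem range_specProj_singleton (hA : IsStarNormal A) {μ : ℂ}
    (hiso : ∀ᶠ w in 𝓝 μ, w ∈ spectrum ℂ A → w = μ) (x : H) :
    x ∈ LinearMap.range (specProj A {μ}).toLinearMap ↔ A x = μ • x := by
  have hiso' : ∀ t ∈ ({μ} : Set ℂ), ∀ᶠ w in 𝓝 t, w ∈ spectrum ℂ A → w = t := by
    rintro t rfl; exact hiso
  have hc := continuousOn_indicator (A := A) (Set.finite_singleton μ) hiso' subset_rfl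
  have hid : ContinuousOn (fun t : ℂ => t - μ) (spectrum ℂ A) := by fun_prop
  have hAμ : cfc (fun t : ℂ => t - μ) A = A - algebraMap ℂ _ μ := by
    rw [cfc_sub (fun t => t) (fun _ => μ) A continuousOn_id continuousOn_const, cfc_const _ A, cfc_id' ℂ A]
  constructor
  · rintro ⟨y, rfl⟩
    have h : (A - algebraMap ℂ _ μ) * specProj A {μ} = 0 := by
      rw [specProj, ← hAμ, ← cfc_mul _ _ A hid hc, ← cfc_zero ℂ A]
      refine cfc_congr fun t _ => ?_
      by_cases h : t = μ <;> simp [h]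
    have := congrArg (fun B : H →L[ℂ] H => B y) h
    simpa [sub_eq_zero, Algebra.algebraMap_eq_smul_one] using this
  · intro hx
    have hg : ContinuousOn (fun t => open Classical in if t ∈ ({μ} : Set ℂ) then (0 : ℂ) else
        (t - μ)⁻¹) (spectrum ℂ A) :=
      continuousOn_of_isolated (Set.finite_singleton μ) hiso' (fun t => (t - μ)⁻¹)
        (fun t ht => if_neg ht) fun t _ ht =>
        (continuousAt_id.sub continuousAt_const).inv₀ (sub_ne_zero.2 ht)
    have h : cfc (fun t => open Classical in if t ∈ ({μ} : Set ℂ) then (0 : ℂ) else (t - μ)⁻¹) A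
        * (A - algebraMap ℂ _ μ) = 1 - specProj A {μ} := by
      rw [one_sub_specProj hA (Set.finite_singleton μ) hiso', ← hAμ, ← cfc_mul _ _ A hg hid]
      refine cfc_congr fun t _ => ?_
      by_cases h : t = μ
      · simp [h]
      · simp [h, sub_ne_zero.2 h]
    have hx' := congrArg (fun B : H →L[ℂ] H => B x) h
    have h0 : (A - algebraMap ℂ (H →L[ℂ] H) μ) x = 0 := by
      simp [hx, Algebra.algebraMap_eq_smul_one]
    rw [mul_apply_eq_comp, h0, map_zero] at hx'
    exact ⟨x, (sub_eq_zero.1 hx'.symm).symm⟩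

/-- The spectral projection for a finite set is the sum of those for its points. -/
theorem specProj_eq_sum (hs : s.Finite)
    (hiso : ∀ t ∈ s, ∀ᶠ w in 𝓝 t, w ∈ spectrum ℂ A → w = t) :
    specProj A s = ∑ t ∈ hs.toFinset, specProj A {t} := by
  unfold specProj
  rw [← cfc_sum _ A _ fun t ht => continuousOn_indicator hs hiso (by simpa using ht)]
  refine cfc_congr fun t _ => ?_
  by_cases h : t ∈ s <;> simp [Finset.sum_apply, h]

end

/-! ### Block diagonal operators -/

/-- The operator that is `α(A)` on the range of the spectral projection `E = specProj A s`, and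
`A + i F Q F` on the orthogonal complement, the range of `F = 1 - E` (for `α t = t` off `s`). -/
noncomputable def blockOp (A : H →L[ℂ] H) (s : Set ℂ) (α : ℂ → ℂ) (Q : H →L[ℂ] H) : H →L[ℂ] H :=
  cfc α A + Complex.I • ((1 - specProj A s) * Q * (1 - specProj A s))

open Classical in
/-- The inverse of `z - α(A)` on the range of `specProj A s`, extended by `0`. -/
noncomputable def innerInv (A : H →L[ℂ] H) (s : Set ℂ) (α : ℂ → ℂ) (z : ℂ) : H →L[ℂ] H :=
  cfc (fun t => if t ∈ s then (z - α t)⁻¹ else 0) A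

open Classical in
/-- The inverse of `z - A` on the range of `1 - specProj A s`, extended by `0`. -/
noncomputable def outerInv (A : H →L[ℂ] H) (s : Set ℂ) (z : ℂ) : H →L[ℂ] H :=
  cfc (fun t => if t ∈ s then 0 else (z - t)⁻¹) A

section

variable {A : H →L[ℂ] H} {s : Set ℂ}

theorem outerInv_mul (hA : IsStarNormal A) (hs : s.Finite)
    (hiso : ∀ t ∈ s, ∀ᶠ w in 𝓝 t, w ∈ spectrum ℂ A → w = t) {α : ℂ → ℂ}
    (hα : ∀ t, t ∉ s → α t = t) {z : ℂ} (hz : ∀ t ∈ spectrum ℂ A, t ∉ s → z ≠ t) :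
    outerInv A s z * (algebraMap ℂ _ z - cfc α A) = 1 - specProj A s ∧
    (algebraMap ℂ _ z - cfc α A) * outerInv A s z = 1 - specProj A s ∧
    outerInv A s z * (1 - specProj A s) = outerInv A s z ∧
    (1 - specProj A s) * outerInv A s z = outerInv A s z := by
  have hαc : ContinuousOn α (spectrum ℂ A) :=
    continuousOn_of_isolated hs hiso (fun t => t) hα fun _ _ _ => continuousAt_id
  have hW : ContinuousOn (fun t => open Classical in if t ∈ s then 0 else (z - t)⁻¹)
      (spectrum ℂ A) :=
    continuousOn_of_isolated hs hiso (fun t => (z - t)⁻¹) (fun t ht => if_neg ht) fun t h1 h2 =>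
      (continuousAt_const.sub continuousAt_id).inv₀ (sub_ne_zero.2 (hz t h1 h2))
  have hF : ContinuousOn (fun t => open Classical in if t ∈ s then (0 : ℂ) else 1)
      (spectrum ℂ A) :=
    continuousOn_of_isolated hs hiso (fun _ => 1) (fun t ht => if_neg ht) fun _ _ _ =>
      continuousAt_const
  have hC : algebraMap ℂ _ z - cfc α A = cfc (fun t => z - α t) A := by
    rw [cfc_sub (fun _ => z) α A continuousOn_const hαc, cfc_const z A]
  have h1 : outerInv A s z * (algebraMap ℂ _ z - cfc α A) = 1 - specProj A s := by
    rw [hC, one_sub_specProj hA hs hiso, outerInv,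
      ← cfc_mul _ _ A hW (show ContinuousOn (fun t => z - α t) _ from
        continuousOn_const.sub hαc)]
    refine cfc_congr fun t ht => ?_
    by_cases h : t ∈ s
    · simp [h]
    · simp [h, hα t h, sub_ne_zero.2 (hz t ht h)]
  have h2 : outerInv A s z * (1 - specProj A s) = outerInv A s z := by
    rw [one_sub_specProj hA hs hiso, outerInv, ← cfc_mul _ _ A hW hF]
    refine cfc_congr fun t ht => ?_
    by_cases h : t ∈ s <;> simp [h]
  refine ⟨h1, ?_, h2, ?_⟩
  · rw [← h1, hC]; exact cfc_commute_cfc _ _ A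
  · conv_rhs => rw [← h2]
    rw [one_sub_specProj hA hs hiso]; exact cfc_commute_cfc _ _ A

theorem innerInv_mul (hA : IsStarNormal A) (hs : s.Finite)
    (hiso : ∀ t ∈ s, ∀ᶠ w in 𝓝 t, w ∈ spectrum ℂ A → w = t) {α : ℂ → ℂ}
    (hα : ∀ t, t ∉ s → α t = t) {z : ℂ} (hz : ∀ t ∈ s, z ≠ α t) :
    innerInv A s α z * (algebraMap ℂ _ z - cfc α A) = specProj A s ∧
    (algebraMap ℂ _ z - cfc α A) * innerInv A s α z = specProj A s ∧
    innerInv A s α z * (1 - specProj A s) = 0 ∧ (1 - specProj A s) * innerInv A s α z = 0 := by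
  have hαc : ContinuousOn α (spectrum ℂ A) :=
    continuousOn_of_isolated hs hiso (fun t => t) hα fun _ _ _ => continuousAt_id
  have hD : ContinuousOn (fun t => open Classical in if t ∈ s then (z - α t)⁻¹ else 0)
      (spectrum ℂ A) :=
    continuousOn_of_isolated hs hiso (fun t => 0) (fun t ht => if_neg ht) fun t h1 h2 =>
      continuousAt_const
  have hF : ContinuousOn (fun t => open Classical in if t ∈ s then (0 : ℂ) else 1)
      (spectrum ℂ A) :=
    continuousOn_of_isolated hs hiso (fun _ => 1) (fun t ht => if_neg ht) fun _ _ _ =>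
      continuousAt_const
  have hC : algebraMap ℂ _ z - cfc α A = cfc (fun t => z - α t) A := by
    rw [cfc_sub (fun _ => z) α A continuousOn_const hαc, cfc_const z A]
  have h1 : innerInv A s α z * (algebraMap ℂ _ z - cfc α A) = specProj A s := by
    rw [hC, specProj, innerInv, ← cfc_mul _ _ A hD (show ContinuousOn (fun t => z - α t) _ from
        continuousOn_const.sub hαc)]
    refine cfc_congr fun t ht => ?_
    by_cases h : t ∈ s
    · simp [h, sub_ne_zero.2 (hz t h)]
    · simp [h]
  have h2 : innerInv A s α z * (1 - specProj A s) = 0 := by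
    rw [one_sub_specProj hA hs hiso, innerInv, ← cfc_mul _ _ A hD hF, ← cfc_zero ℂ A]
    refine cfc_congr fun t ht => ?_
    by_cases h : t ∈ s <;> simp [h]
  refine ⟨h1, ?_, h2, ?_⟩
  · rw [← h1, hC]; exact cfc_commute_cfc _ _ A
  · rw [← h2, one_sub_specProj hA hs hiso]; exact cfc_commute_cfc _ _ A

theorem norm_outerInv_le {z : ℂ} {κ : ℝ} (hκ : 0 < κ)
    (hz : ∀ t ∈ spectrum ℂ A, t ∉ s → κ ≤ ‖z - t‖) : ‖outerInv A s z‖ ≤ κ⁻¹ :=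
  norm_cfc_le (by positivity) fun t ht => by
    split_ifs with h
    · simp [hκ.le]
    · rw [norm_inv]; exact inv_anti₀ hκ (hz t ht h)

theorem norm_innerInv_le {α : ℂ → ℂ} {z : ℂ} {r : ℝ} (hr : 0 < r)
    (hz : ∀ t ∈ s, r ≤ ‖z - α t‖) : ‖innerInv A s α z‖ ≤ r⁻¹ :=
  norm_cfc_le (by positivity) fun t _ => by
    split_ifs with h
    · rw [norm_inv]; exact inv_anti₀ hr (hz t h)
    · simp [hr.le]

theorem norm_I_smul_compression_mul_le (hA : IsStarNormal A) (hs : s.Finite)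
    (hiso : ∀ t ∈ s, ∀ᶠ w in 𝓝 t, w ∈ spectrum ℂ A → w = t) {Q G : H →L[ℂ] H} (hQ : ‖Q‖ ≤ 1) :
    ‖Complex.I • ((1 - specProj A s) * Q * G)‖ ≤ ‖G‖ := by
  rw [norm_smul, Complex.norm_I, one_mul]
  calc _ ≤ ‖1 - specProj A s‖ * ‖Q‖ * ‖G‖ :=
        (norm_mul_le _ _).trans (mul_le_mul_of_nonneg_right (norm_mul_le _ _) (norm_nonneg _))
    _ ≤ 1 * 1 * ‖G‖ := by
        gcongr
        exact norm_one_sub_specProj_le hA hs hiso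
    _ = ‖G‖ := by ring

/-- A point `z` at distance at least `κ > 1` from the spectrum of `A` off `s` is in the resolvent
set of the outer block, since the perturbation `i F Q F` has norm at most one. -/
theorem mem_resolventSet_blockOp (hA : IsStarNormal A) (hs : s.Finite)
    (hiso : ∀ t ∈ s, ∀ᶠ w in 𝓝 t, w ∈ spectrum ℂ A → w = t) {α : ℂ → ℂ}
    (hα : ∀ t, t ∉ s → α t = t) {Q : H →L[ℂ] H} (hQ : ‖Q‖ ≤ 1) {z : ℂ} {κ : ℝ} (hκ : 1 < κ)
    (hz : ∀ t ∈ spectrum ℂ A, t ∉ s → κ ≤ ‖z - t‖) (hzα : ∀ t ∈ s, z ≠ α t) :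
    z ∈ resolventSet ℂ (blockOp A s α Q) := by
  have hz' : ∀ t ∈ spectrum ℂ A, t ∉ s → z ≠ t := by
    rintro t h1 h2 rfl
    have := hz z h1 h2
    rw [sub_self, norm_zero] at this; linarith
  obtain ⟨hW1, hW2, -, hW4⟩ := outerInv_mul hA hs hiso hα hz'
  obtain ⟨hD1, hD2, -, hD4⟩ := innerInv_mul hA hs hiso hα hzα
  set W := outerInv A s z
  set D := innerInv A s α z
  set E := specProj A s with hE
  have hu : IsUnit (algebraMap ℂ (H →L[ℂ] H) z - cfc α A) :=
    ⟨⟨_, D + W, by rw [mul_add, hD2, hW2]; abel, by rw [add_mul, hD1, hW1]; abel⟩, rfl⟩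
  have hN : ‖Complex.I • ((1 - E) * Q * W)‖ < 1 :=
    ((norm_I_smul_compression_mul_le hA hs hiso hQ).trans
      (norm_outerInv_le (by linarith) hz)).trans_lt (inv_lt_one_of_one_lt₀ hκ)
  have e : algebraMap ℂ (H →L[ℂ] H) z - blockOp A s α Q
      = (1 - Complex.I • ((1 - E) * Q * W)) * (algebraMap ℂ (H →L[ℂ] H) z - cfc α A) := by
    rw [sub_mul, one_mul, smul_mul_assoc, mul_assoc _ W, hW1, blockOp, ← hE]
    abel
  rw [spectrum.mem_resolventSet_iff, e]
  exact (isUnit_one_sub_of_norm_lt_one hN).mul hu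

theorem specProj_mul_resolvent_blockOp (hA : IsStarNormal A) (hs : s.Finite)
    (hiso : ∀ t ∈ s, ∀ᶠ w in 𝓝 t, w ∈ spectrum ℂ A → w = t) {α : ℂ → ℂ}
    (hα : ∀ t, t ∉ s → α t = t) {Q : H →L[ℂ] H} {z : ℂ} (hzα : ∀ t ∈ s, z ≠ α t)
    (hz : z ∈ resolventSet ℂ (blockOp A s α Q)) :
    specProj A s * resolvent (blockOp A s α Q) z = innerInv A s α z := by
  obtain ⟨hD1, -, hD3, -⟩ := innerInv_mul hA hs hiso hα hzα
  have h : innerInv A s α z * (algebraMap ℂ _ z - blockOp A s α Q) = specProj A s := by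
    rw [blockOp, ← sub_sub, mul_sub, hD1, mul_smul_comm, ← mul_assoc, ← mul_assoc, hD3]
    simp
  rw [← h, mul_assoc, sub_mul_resolvent hz, mul_one]

theorem norm_one_sub_specProj_mul_resolvent_blockOp_le (hA : IsStarNormal A) (hs : s.Finite)
    (hiso : ∀ t ∈ s, ∀ᶠ w in 𝓝 t, w ∈ spectrum ℂ A → w = t) {α : ℂ → ℂ}
    (hα : ∀ t, t ∉ s → α t = t) {Q : H →L[ℂ] H} (hQ : ‖Q‖ ≤ 1) {z : ℂ} {κ : ℝ} (hκ : 1 < κ)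
    (hz : ∀ t ∈ spectrum ℂ A, t ∉ s → κ ≤ ‖z - t‖)
    (hzB : z ∈ resolventSet ℂ (blockOp A s α Q)) :
    ‖(1 - specProj A s) * resolvent (blockOp A s α Q) z‖ ≤ (κ - 1)⁻¹ := by
  have hz' : ∀ t ∈ spectrum ℂ A, t ∉ s → z ≠ t := by
    rintro t h1 h2 rfl
    have := hz z h1 h2
    rw [sub_self, norm_zero] at this; linarith
  obtain ⟨hW1, -, hW3, -⟩ := outerInv_mul hA hs hiso hα hz'
  have hWn := norm_outerInv_le (A := A) (by linarith) hz
  set W := outerInv A s z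
  set E := specProj A s with hE
  set G := resolvent (blockOp A s α Q) z with hG
  have e : (1 - E) * G = W + Complex.I • (W * (Q * ((1 - E) * G))) := by
    have h : W * (algebraMap ℂ (H →L[ℂ] H) z - blockOp A s α Q)
        = (1 - E) - Complex.I • (W * Q * (1 - E)) := by
      rw [blockOp, ← sub_sub, mul_sub, hW1, mul_smul_comm, ← hE, ← mul_assoc, ← mul_assoc, hW3]
    have h' : W = (1 - E) * G - Complex.I • (W * Q * (1 - E)) * G := by
      rw [← sub_mul, ← h, mul_assoc, hG, sub_mul_resolvent hzB, mul_one]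
    rw [eq_sub_iff_add_eq, smul_mul_assoc, mul_assoc, mul_assoc] at h'
    exact h'.symm
  have h1 : ‖(1 - E) * G‖ ≤ κ⁻¹ + κ⁻¹ * ‖(1 - E) * G‖ := by
    calc ‖(1 - E) * G‖ = ‖W + Complex.I • (W * (Q * ((1 - E) * G)))‖ := by rw [← e]
      _ ≤ ‖W‖ + ‖W‖ * (‖Q‖ * ‖(1 - E) * G‖) := by
          refine (norm_add_le _ _).trans (add_le_add le_rfl ?_)
          rw [norm_smul, Complex.norm_I, one_mul]
          exact (norm_mul_le _ _).trans
            (mul_le_mul_of_nonneg_left (norm_mul_le _ _) (norm_nonneg _))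
      _ ≤ κ⁻¹ + κ⁻¹ * (1 * ‖(1 - E) * G‖) := by gcongr
      _ = _ := by ring
  have hκ0 : 0 < κ := by linarith
  have h2 : κ * ‖(1 - E) * G‖ ≤ 1 + ‖(1 - E) * G‖ := by
    calc κ * ‖(1 - E) * G‖ ≤ κ * (κ⁻¹ + κ⁻¹ * ‖(1 - E) * G‖) := by gcongr
      _ = 1 + ‖(1 - E) * G‖ := by field_simp
  rw [← one_div, le_div_iff₀ (by linarith)]
  linarith

/-! ### The spectral subspace of a block diagonal operator -/

theorem specProj_singleton_mul_cfc (hA : IsStarNormal A) (hs : s.Finite)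
    (hiso : ∀ t ∈ s, ∀ᶠ w in 𝓝 t, w ∈ spectrum ℂ A → w = t) {α : ℂ → ℂ}
    (hα : ∀ t, t ∉ s → α t = t) {μ : ℂ} (hμ : μ ∈ s) :
    specProj A {μ} * cfc α A = α μ • specProj A {μ} ∧
    cfc α A * specProj A {μ} = α μ • specProj A {μ} ∧
    specProj A {μ} * (1 - specProj A s) = 0 ∧ (1 - specProj A s) * specProj A {μ} = 0 := by
  have hαc : ContinuousOn α (spectrum ℂ A) :=
    continuousOn_of_isolated hs hiso (fun t => t) hα fun _ _ _ => continuousAt_id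
  have hF : ContinuousOn (fun t => open Classical in if t ∈ s then (0 : ℂ) else 1)
      (spectrum ℂ A) :=
    continuousOn_of_isolated hs hiso (fun _ => 1) (fun t ht => if_neg ht) fun _ _ _ =>
      continuousAt_const
  have hP := continuousOn_indicator (A := A) hs hiso (Set.singleton_subset_iff.2 hμ)
  have h1 : specProj A {μ} * cfc α A = α μ • specProj A {μ} := by
    rw [specProj, ← cfc_mul _ _ A hP hαc, ← cfc_const_mul (α μ) _ A hP]
    refine cfc_congr fun t _ => ?_
    by_cases h : t = μ <;> simp [h]
  have h2 : specProj A {μ} * (1 - specProj A s) = 0 := by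
    rw [one_sub_specProj hA hs hiso, specProj, ← cfc_mul _ _ A hP hF, ← cfc_zero ℂ A]
    refine cfc_congr fun t _ => ?_
    by_cases h : t = μ
    · simp [h, hμ]
    · simp [h]
  refine ⟨h1, ?_, h2, ?_⟩
  · rw [← h1]; exact cfc_commute_cfc _ _ A
  · rw [← h2, one_sub_specProj hA hs hiso]; exact cfc_commute_cfc _ _ A

/-- The Riesz projection of a block diagonal operator for a circle around `α μ` which encloses
neither another value of `α` on `s` nor a spectral point of the outer block. On the range of
`1 - specProj A {μ}` the operator may be shifted by one on the eigenspace of `μ`, and this moves the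
only singularity of the resolvent out of the disc. -/
theorem rieszProjection_blockOp (hA : IsStarNormal A) (hs : s.Finite)
    (hiso : ∀ t ∈ s, ∀ᶠ w in 𝓝 t, w ∈ spectrum ℂ A → w = t) {α : ℂ → ℂ}
    (hα : ∀ t, t ∉ s → α t = t) {Q : H →L[ℂ] H} (hQ : ‖Q‖ ≤ 1) {κ : ℝ} (hκ : 1 < κ) {μ : ℂ}
    (hμ : μ ∈ s) {r : ℝ} (hr : 0 < r) (hr1 : r < 1)
    (hz : ∀ z ∈ Metric.closedBall (α μ) r, ∀ t ∈ spectrum ℂ A, t ∉ s → κ ≤ ‖z - t‖)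
    (hsep : ∀ z ∈ Metric.closedBall (α μ) r, ∀ t ∈ s, t ≠ μ → z ≠ α t) :
    rieszProjection (blockOp A s α Q) (α μ) r = specProj A {μ} := by
  classical
  obtain ⟨hP1, hP2, hP3, hP4⟩ := specProj_singleton_mul_cfc hA hs hiso hα hμ
  let β : ℂ → ℂ := fun t => α t + if t ∈ ({μ} : Set ℂ) then 1 else 0
  have hβ : ∀ t, t ∉ s → β t = t := fun t ht => by
    have : t ≠ μ := fun h => ht (h ▸ hμ)
    simp [β, this, hα t ht]
  have hαc : ContinuousOn α (spectrum ℂ A) :=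
    continuousOn_of_isolated hs hiso (fun t => t) hα fun _ _ _ => continuousAt_id
  have hPc := continuousOn_indicator (A := A) hs hiso (Set.singleton_subset_iff.2 hμ)
  have hBβ : blockOp A s β Q = blockOp A s α Q + specProj A {μ} := by
    have : cfc β A = cfc α A + specProj A {μ} := by
      rw [specProj, ← cfc_add A _ _ hαc hPc]
      exact cfc_congr fun t _ => by simp only [β]; congr
    rw [blockOp, blockOp, this]; abel
  have hPP : specProj A {μ} * specProj A {μ} = specProj A {μ} :=
    specProj_mul_self (Set.finite_singleton μ) fun t ht => hiso t (by
      rw [Set.mem_singleton_iff.1 ht]; exact hμ)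
  set P := specProj A {μ} with hPdef
  set B := blockOp A s α Q with hB
  -- the shifted operator has no spectrum in the closed disc
  have hρβ : Metric.closedBall (α μ) r ⊆ resolventSet ℂ (blockOp A s β Q) := fun z hzb => by
    refine mem_resolventSet_blockOp hA hs hiso hβ hQ hκ (hz z hzb) fun t ht => ?_
    by_cases h : t = μ
    · rintro rfl
      rw [mem_closedBall_iff_norm] at hzb
      simp only [β, h, Set.mem_singleton_iff, if_true, add_sub_cancel_left, norm_one] at hzb
      linarith
    · simpa [β, h] using hsep z hzb t ht h
  have hρ : Metric.sphere (α μ) r ⊆ resolventSet ℂ B := fun z hzs => by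
    have hzb := Metric.sphere_subset_closedBall hzs
    refine mem_resolventSet_blockOp hA hs hiso hα hQ hκ (hz z hzb) fun t ht => ?_
    by_cases h : t = μ
    · rintro rfl
      rw [h, mem_sphere_iff_norm, sub_self, norm_zero] at hzs
      linarith
    · exact hsep z hzb t ht h
  have hPB : P * B = α μ • P := by
    rw [hB, blockOp, mul_add, hP1, mul_smul_comm, ← mul_assoc, ← mul_assoc, hP3]; simp
  have hBP : B * P = α μ • P := by
    rw [hB, blockOp, add_mul, hP2, smul_mul_assoc, mul_assoc, hP4]; simp
  have key : ∀ z ∈ Metric.sphere (α μ) r, resolvent B z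
      = (z - α μ)⁻¹ • P + (1 - P) * resolvent (blockOp A s β Q) z := by
    intro z hzs
    have hzB := hρ hzs
    have hzβ := hρβ (Metric.sphere_subset_closedBall hzs)
    have hne : z - α μ ≠ 0 := fun h => by
      rw [mem_sphere_iff_norm, h, norm_zero] at hzs; linarith
    have e1 : resolvent B z * P = (z - α μ)⁻¹ • P := by
      have : (algebraMap ℂ (H →L[ℂ] H) z - B) * P = (z - α μ) • P := by
        rw [sub_mul, hBP, Algebra.algebraMap_eq_smul_one, sub_smul]; simp
      have h2 : P = (z - α μ) • (resolvent B z * P) := by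
        rw [← mul_smul_comm, ← this, ← mul_assoc, resolvent_mul_sub hzB, one_mul]
      rw [eq_inv_smul_iff₀ hne, ← h2]
    have e2 : resolvent B z * (1 - P) = (1 - P) * resolvent (blockOp A s β Q) z := by
      have hcomm : (1 - P) * (algebraMap ℂ (H →L[ℂ] H) z - B)
          = (algebraMap ℂ (H →L[ℂ] H) z - B) * (1 - P) := by
        have hc := Algebra.commutes z P
        simp only [sub_mul, mul_sub, one_mul, mul_one, hPB, hBP, hc]
        abel
      have hshift : (1 - P) * (algebraMap ℂ (H →L[ℂ] H) z - blockOp A s β Q)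
          = (algebraMap ℂ (H →L[ℂ] H) z - B) * (1 - P) := by
        rw [hBβ, ← sub_sub, mul_sub, hcomm, sub_mul 1 P P, hPP, one_mul, sub_self, sub_zero]
      calc resolvent B z * (1 - P)
          = resolvent B z * ((1 - P) * (algebraMap ℂ _ z - blockOp A s β Q))
              * resolvent (blockOp A s β Q) z := by
            rw [mul_assoc, mul_assoc, sub_mul_resolvent hzβ, mul_one]
        _ = _ := by rw [hshift, ← mul_assoc, resolvent_mul_sub hzB, one_mul]
    calc resolvent B z = resolvent B z * P + resolvent B z * (1 - P) := by noncomm_ring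
      _ = _ := by rw [e1, e2]
  have hd : DifferentiableOn ℂ (fun z => (1 - P) * resolvent (blockOp A s β Q) z)
      (Metric.closedBall (α μ) r) :=
    ((differentiableOn_resolvent _).mono hρβ).const_mul _
  have h0 : ∮ z in C(α μ, r), (1 - P) * resolvent (blockOp A s β Q) z = 0 :=
    (DifferentiableOn.diffContOnCl (s := Metric.ball (α μ) r) (by
      rwa [closure_ball _ hr.ne'])).circleIntegral_eq_zero hr.le
  have hinv : ContinuousOn (fun z => (z - α μ)⁻¹) (Metric.sphere (α μ) r) :=
    (continuousOn_id.sub continuousOn_const).inv₀ fun z hzs h => by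
      change z - α μ = 0 at h
      rw [mem_sphere_iff_norm, h, norm_zero] at hzs; linarith
  have hi : CircleIntegrable (fun z => (z - α μ)⁻¹ • P) (α μ) r :=
    (hinv.smul continuousOn_const).circleIntegrable hr.le
  rw [rieszProjection, circleIntegral.integral_congr hr.le key, circleIntegral.integral_add hi
      ((hd.continuousOn.mono Metric.sphere_subset_closedBall).circleIntegrable hr.le),
    h0, add_zero, circleIntegral.integral_smul_const,
    circleIntegral.integral_sub_center_inv _ hr.ne', smul_smul,
    inv_mul_cancel₀ (by simp [Real.pi_ne_zero]), one_smul]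

end

/-! ### Perturbation by the off-diagonal blocks -/

open Classical in
/-- The shift of the points of `s` by `i`; this describes the spectrum of `A + i E`. -/
noncomputable def shiftOn (s : Set ℂ) (t : ℂ) : ℂ := t + if t ∈ s then Complex.I else 0

/-- The operator `E + ρ F`, where `E = specProj A s` and `F = 1 - E`. -/
noncomputable def blockScale (A : H →L[ℂ] H) (s : Set ℂ) (ρ : ℂ) : H →L[ℂ] H :=
  specProj A s + ρ • (1 - specProj A s)

/-- The difference between `Q`, conjugated by `E + √r F`, and its block diagonal model `E + F Q F`. -/
noncomputable def offDiag (A : H →L[ℂ] H) (s : Set ℂ) (Q : H →L[ℂ] H) (r : ℝ) : H →L[ℂ] H :=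
  -(specProj A s * (1 - Q) * specProj A s)
    + ((√r : ℝ) : ℂ)⁻¹ • (specProj A s * Q * (1 - specProj A s))
    + ((√r : ℝ) : ℂ) • ((1 - specProj A s) * Q * specProj A s)

section

variable {A : H →L[ℂ] H} {s : Set ℂ}

theorem blockScale_mul_blockScale (hs : s.Finite)
    (hiso : ∀ t ∈ s, ∀ᶠ w in 𝓝 t, w ∈ spectrum ℂ A → w = t) {ρ ρ' : ℂ} (h : ρ * ρ' = 1) :
    blockScale A s ρ * blockScale A s ρ' = 1 := by
  have hEE := specProj_mul_self hs hiso
  rw [blockScale, blockScale]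
  set E := specProj A s
  have hEF : E * (1 - E) = 0 := by rw [mul_sub, hEE, mul_one, sub_self]
  have hFE : (1 - E) * E = 0 := by rw [sub_mul, hEE, one_mul, sub_self]
  have hFF : (1 - E) * (1 - E) = 1 - E := by rw [mul_sub, hFE, mul_one, sub_zero]
  simp only [add_mul, mul_add, smul_mul_assoc, mul_smul_comm, hEE, hEF, hFE, hFF, smul_zero,
    smul_smul, mul_comm ρ' ρ, h, one_smul, zero_add, add_zero]
  abel

theorem blockScale_conj (hA : IsStarNormal A) (hs : s.Finite)
    (hiso : ∀ t ∈ s, ∀ᶠ w in 𝓝 t, w ∈ spectrum ℂ A → w = t) (Q : H →L[ℂ] H) {r : ℝ} (hr : 0 < r) :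
    blockScale A s ((√r : ℝ) : ℂ) * (A + Complex.I • Q) * blockScale A s ((√r : ℝ) : ℂ)⁻¹
      = blockOp A s (shiftOn s) Q + Complex.I • offDiag A s Q r := by
  classical
  have hEE := specProj_mul_self hs hiso
  have hPc := continuousOn_indicator (A := A) hs hiso subset_rfl
  have hr' : ((√r : ℝ) : ℂ) ≠ 0 := by exact_mod_cast (Real.sqrt_pos.2 hr).ne'
  have hc : cfc (shiftOn s) A = A + Complex.I • specProj A s := by
    rw [specProj, ← cfc_const_mul Complex.I _ A hPc]
    have hid := cfc_id' ℂ A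
    conv_rhs => enter [1]; rw [← hid]
    have hIc : ContinuousOn (fun t => Complex.I * if t ∈ s then (1 : ℂ) else 0) (spectrum ℂ A) :=
      continuousOn_const.mul hPc
    rw [← cfc_add A (fun t => t) _ continuousOn_id hIc]
    refine cfc_congr fun t _ => ?_
    by_cases h : t ∈ s <;> simp [shiftOn, h]
  have hAE : specProj A s * A = A * specProj A s := by
    have := cfc_commute_cfc (fun t => open Classical in if t ∈ s then (1 : ℂ) else 0) (fun t => t) A
    rw [cfc_id' ℂ A] at this
    exact this
  have hAS : blockScale A s ((√r : ℝ) : ℂ) * A = A * blockScale A s ((√r : ℝ) : ℂ) := by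
    rw [blockScale, add_mul, mul_add, smul_mul_assoc, mul_smul_comm, sub_mul, mul_sub, hAE, one_mul,
      mul_one]
  rw [mul_add, add_mul, hAS, mul_assoc, blockScale_mul_blockScale hs hiso (mul_inv_cancel₀ hr'),
    mul_one, blockOp, hc, offDiag, blockScale, blockScale]
  generalize ((√r : ℝ) : ℂ) = ρ at hr' ⊢
  set E := specProj A s
  set F := 1 - E
  have hX : E * (1 - Q) * E = E - E * Q * E := by rw [mul_sub, sub_mul, mul_one, hEE]
  have hQ : (E + ρ • F) * Q * (E + ρ⁻¹ • F)
      = E * Q * E + ρ⁻¹ • (E * Q * F) + ρ • (F * Q * E) + F * Q * F := by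
    simp only [add_mul, mul_add, smul_mul_assoc, mul_smul_comm, smul_add, smul_smul,
      inv_mul_cancel₀ hr', one_smul]
    abel
  rw [hX, mul_smul_comm, smul_mul_assoc, hQ]
  simp only [smul_add, smul_sub, smul_neg]
  abel

/-- The off-diagonal blocks `E Q F`, `F Q E` are of order `ε` and the block `E (1 - Q) E` of order
`ε²`, so that the bounds for the two blocks of the resolvent outweigh them as soon as `ε² ≪ r`. -/
theorem norm_offDiag_mul_le (hA : IsStarNormal A) (hs : s.Finite)
    (hiso : ∀ t ∈ s, ∀ᶠ w in 𝓝 t, w ∈ spectrum ℂ A → w = t) {Q : H →L[ℂ] H}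
    (hQ : IsStarProjection Q) {G : H →L[ℂ] H} {ε r M : ℝ} (hr : 0 < r) (hε : 0 ≤ ε)
    (hQε : ‖(1 - Q) * specProj A s‖ ≤ ε) (hG1 : ‖specProj A s * G‖ ≤ r⁻¹)
    (hG2 : ‖(1 - specProj A s) * G‖ ≤ M) :
    ‖offDiag A s Q r * G‖ ≤ (ε / √r) ^ 2 + M * (ε / √r) + ε / √r := by
  have hE := isSelfAdjoint_specProj A s
  have hEE := specProj_mul_self hs hiso
  have hF1 := norm_one_sub_specProj_le hA hs hiso
  unfold offDiag
  set E := specProj A s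
  have hFE : (1 - E) * E = 0 := by rw [sub_mul, hEE, one_mul, sub_self]
  have hFF : (1 - E) * (1 - E) = 1 - E := by rw [mul_sub, hFE, mul_one, sub_zero]
  have hQQ : (1 - Q) * (1 - Q) = 1 - Q := by
    rw [mul_sub, mul_one, sub_mul, one_mul, hQ.isIdempotentElem.eq, sub_self, sub_zero]
  have hs1 : star (1 - Q) = 1 - Q := by rw [star_sub, star_one, hQ.isSelfAdjoint.star_eq]
  have h1 : ‖E * (1 - Q)‖ ≤ ε := by
    rw [← norm_star, star_mul, hs1, hE.star_eq]; exact hQε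
  have hX : ‖E * (1 - Q) * E‖ ≤ ε * ε := by
    have : E * (1 - Q) * E = (E * (1 - Q)) * ((1 - Q) * E) := by
      rw [mul_assoc, mul_assoc, ← mul_assoc (1 - Q), hQQ]
    rw [this]
    exact (norm_mul_le _ _).trans (mul_le_mul h1 hQε (norm_nonneg _) hε)
  have hFQE : ‖(1 - E) * Q * E‖ ≤ ε := by
    have : (1 - E) * Q * E = -((1 - E) * ((1 - Q) * E)) := by
      rw [sub_mul 1 Q, mul_sub (1 - E), one_mul, hFE]; noncomm_ring
    rw [this, norm_neg]
    calc _ ≤ ‖1 - E‖ * ‖(1 - Q) * E‖ := norm_mul_le _ _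
      _ ≤ 1 * ε := by gcongr
      _ = ε := one_mul _
  have hEQF : ‖E * Q * (1 - E)‖ ≤ ε := by
    rw [← norm_star, star_mul, star_mul, hE.star_eq, hQ.isSelfAdjoint.star_eq, star_sub, star_one,
      hE.star_eq, ← mul_assoc]
    exact hFQE
  have e : (-(E * (1 - Q) * E) + ((√r : ℝ) : ℂ)⁻¹ • (E * Q * (1 - E))
      + ((√r : ℝ) : ℂ) • ((1 - E) * Q * E)) * G
      = -((E * (1 - Q) * E) * (E * G)) + ((√r : ℝ) : ℂ)⁻¹ • ((E * Q * (1 - E)) * ((1 - E) * G))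
        + ((√r : ℝ) : ℂ) • (((1 - E) * Q * E) * (E * G)) := by
    rw [← mul_assoc (E * (1 - Q) * E), mul_assoc _ E E, hEE,
      ← mul_assoc (E * Q * (1 - E)), mul_assoc _ (1 - E) (1 - E), hFF,
      ← mul_assoc ((1 - E) * Q * E), mul_assoc _ E E, hEE]
    simp only [add_mul, neg_mul, smul_mul_assoc]
  have hsq : 0 < √r := Real.sqrt_pos.2 hr
  have hM : 0 ≤ M := (norm_nonneg _).trans hG2
  rw [e]
  calc _ ≤ ‖E * (1 - Q) * E‖ * ‖E * G‖ + (√r)⁻¹ * (‖E * Q * (1 - E)‖ * ‖(1 - E) * G‖)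
        + √r * (‖(1 - E) * Q * E‖ * ‖E * G‖) := by
        refine (norm_add₃_le).trans ?_
        rw [norm_neg, norm_smul, norm_smul, norm_inv, Complex.norm_real, Real.norm_eq_abs,
          abs_of_pos hsq]
        gcongr <;> exact norm_mul_le _ _
    _ ≤ ε * ε * r⁻¹ + (√r)⁻¹ * (ε * M) + √r * (ε * r⁻¹) := by gcongr
    _ = (ε / √r) ^ 2 + M * (ε / √r) + ε / √r := by
        have h2 : r⁻¹ = (√r)⁻¹ * (√r)⁻¹ := by rw [← mul_inv, Real.mul_self_sqrt hr.le]
        rw [h2]; field_simp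

/-- A perturbation `Y` that is small relative to the resolvent of `B` preserves the resolvent set
and changes the resolvent by a controlled amount. -/
theorem resolvent_add_of_norm_mul_le {B Y : H →L[ℂ] H} {z : ℂ} (hz : z ∈ resolventSet ℂ B)
    {θ : ℝ} (hθ : θ < 1) (h : ‖Y * resolvent B z‖ ≤ θ) :
    z ∈ resolventSet ℂ (B + Y) ∧
      ‖resolvent (B + Y) z - resolvent B z‖ ≤ θ / (1 - θ) * ‖resolvent B z‖ := by
  have e : algebraMap ℂ (H →L[ℂ] H) z - (B + Y)
      = (1 - Y * resolvent B z) * (algebraMap ℂ (H →L[ℂ] H) z - B) := by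
    rw [sub_mul, one_mul, mul_assoc, resolvent_mul_sub hz, mul_one]; abel
  have hz' : z ∈ resolventSet ℂ (B + Y) := by
    rw [spectrum.mem_resolventSet_iff, e]
    exact (isUnit_one_sub_of_norm_lt_one (h.trans_lt hθ)).mul hz
  refine ⟨hz', ?_⟩
  have hd : resolvent (B + Y) z - resolvent B z = resolvent (B + Y) z * (Y * resolvent B z) := by
    have h1 : resolvent (B + Y) z * (1 - Y * resolvent B z) = resolvent B z := by
      calc _ = resolvent (B + Y) z * ((1 - Y * resolvent B z)
            * ((algebraMap ℂ (H →L[ℂ] H) z - B) * resolvent B z)) := by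
            rw [sub_mul_resolvent hz, mul_one]
        _ = _ := by rw [← mul_assoc (1 - _), ← e, ← mul_assoc, resolvent_mul_sub hz', one_mul]
    rw [mul_sub, mul_one] at h1
    rw [sub_eq_iff_eq_add]; exact (sub_eq_iff_eq_add'.1 h1)
  have h2 : ‖resolvent (B + Y) z - resolvent B z‖ ≤ ‖resolvent (B + Y) z‖ * θ := by
    rw [hd]
    exact (norm_mul_le _ _).trans (mul_le_mul_of_nonneg_left h (norm_nonneg _))
  have h3 : ‖resolvent (B + Y) z‖ ≤ ‖resolvent B z‖ + ‖resolvent (B + Y) z - resolvent B z‖ :=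
    norm_le_norm_add_norm_sub' _ _
  have hθ0 : 0 ≤ θ := (norm_nonneg _).trans h
  rw [div_mul_eq_mul_div, le_div_iff₀ (by linarith)]
  nlinarith

end

/-! ### The spectrum of `A + i Q` -/

section

variable {A : H →L[ℂ] H} {s : Set ℂ}

theorem shiftOn_of_mem {t : ℂ} (ht : t ∈ s) : shiftOn s t = t + Complex.I := by simp [shiftOn, ht]

theorem shiftOn_of_notMem {t : ℂ} (ht : t ∉ s) : shiftOn s t = t := by simp [shiftOn, ht]

/-- The resolvent of `A + i Q`, conjugated by `E + √r F`, at a point `z` that has distance at least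
`r` from the shifted points `t + i` for `t ∈ s`, and distance at least `κ > 1` from the rest of the
spectrum of `A`. -/
theorem resolvent_conj_add_I_smul (hA : IsStarNormal A) (hs : s.Finite)
    (hiso : ∀ t ∈ s, ∀ᶠ w in 𝓝 t, w ∈ spectrum ℂ A → w = t) {Q : H →L[ℂ] H}
    (hQ : IsStarProjection Q) (hQ1 : ‖Q‖ ≤ 1) {κ : ℝ} (hκ : 1 < κ) {c ε r : ℝ} (hr : 0 < r)
    (hc : c ^ 2 + (κ - 1)⁻¹ * c + c ≤ 1 / 4) (hε : 0 ≤ ε)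
    (hQε : ‖(1 - Q) * specProj A s‖ ≤ ε) (hεr : ε ≤ c * √r)
    {z : ℂ} (hz : ∀ t ∈ spectrum ℂ A, t ∉ s → κ ≤ ‖z - t‖)
    (hzs : ∀ t ∈ s, r ≤ ‖z - (t + Complex.I)‖) :
    z ∈ resolventSet ℂ (blockScale A s ((√r : ℝ) : ℂ) * (A + Complex.I • Q)
        * blockScale A s ((√r : ℝ) : ℂ)⁻¹) ∧
      z ∈ resolventSet ℂ (blockOp A s (shiftOn s) Q) ∧
      ‖resolvent (blockScale A s ((√r : ℝ) : ℂ) * (A + Complex.I • Q)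
          * blockScale A s ((√r : ℝ) : ℂ)⁻¹) z - resolvent (blockOp A s (shiftOn s) Q) z‖
        ≤ 1 / 3 * (r⁻¹ + (κ - 1)⁻¹) := by
  have hα : ∀ t, t ∉ s → shiftOn s t = t := fun t ht => shiftOn_of_notMem ht
  have hzs' : ∀ t ∈ s, r ≤ ‖z - shiftOn s t‖ := fun t ht => by
    rw [shiftOn_of_mem ht]; exact hzs t ht
  have hne : ∀ t ∈ s, z ≠ shiftOn s t := fun t ht h => by
    have := hzs' t ht
    rw [h, sub_self, norm_zero] at this; linarith
  have hzB := mem_resolventSet_blockOp hA hs hiso hα hQ1 hκ hz hne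
  have hG1 : ‖specProj A s * resolvent (blockOp A s (shiftOn s) Q) z‖ ≤ r⁻¹ := by
    rw [specProj_mul_resolvent_blockOp hA hs hiso hα hne hzB]
    exact norm_innerInv_le hr hzs'
  have hG2 := norm_one_sub_specProj_mul_resolvent_blockOp_le hA hs hiso hα hQ1 hκ hz hzB
  have hsq : 0 < √r := Real.sqrt_pos.2 hr
  have hεc : ε / √r ≤ c := by rwa [div_le_iff₀ hsq]
  have hκ' : 0 ≤ (κ - 1)⁻¹ := inv_nonneg.2 (by linarith)
  have hY : ‖(Complex.I • offDiag A s Q r) * resolvent (blockOp A s (shiftOn s) Q) z‖ ≤ 1 / 4 := by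
    rw [smul_mul_assoc, norm_smul, Complex.norm_I, one_mul]
    refine (norm_offDiag_mul_le hA hs hiso hQ hr hε hQε hG1 hG2).trans (le_trans ?_ hc)
    gcongr
  have hG : ‖resolvent (blockOp A s (shiftOn s) Q) z‖ ≤ r⁻¹ + (κ - 1)⁻¹ := by
    calc _ = ‖specProj A s * resolvent (blockOp A s (shiftOn s) Q) z
          + (1 - specProj A s) * resolvent (blockOp A s (shiftOn s) Q) z‖ := by
          congr 1; noncomm_ring
      _ ≤ _ := (norm_add_le _ _).trans (add_le_add hG1 hG2)
  obtain ⟨h1, h2⟩ := resolvent_add_of_norm_mul_le hzB (by norm_num) hY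
  rw [blockScale_conj hA hs hiso Q hr]
  refine ⟨h1, hzB, h2.trans ?_⟩
  norm_num
  linarith

theorem mem_resolventSet_add_I_smul (hA : IsStarNormal A) (hs : s.Finite)
    (hiso : ∀ t ∈ s, ∀ᶠ w in 𝓝 t, w ∈ spectrum ℂ A → w = t) {Q : H →L[ℂ] H}
    (hQ : IsStarProjection Q) (hQ1 : ‖Q‖ ≤ 1) {κ : ℝ} (hκ : 1 < κ) {c ε r : ℝ} (hr : 0 < r)
    (hc : c ^ 2 + (κ - 1)⁻¹ * c + c ≤ 1 / 4) (hε : 0 ≤ ε)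
    (hQε : ‖(1 - Q) * specProj A s‖ ≤ ε) (hεr : ε ≤ c * √r)
    {z : ℂ} (hz : ∀ t ∈ spectrum ℂ A, t ∉ s → κ ≤ ‖z - t‖)
    (hzs : ∀ t ∈ s, r ≤ ‖z - (t + Complex.I)‖) : z ∈ resolventSet ℂ (A + Complex.I • Q) := by
  have hr' : ((√r : ℝ) : ℂ) ≠ 0 := by exact_mod_cast (Real.sqrt_pos.2 hr).ne'
  exact (resolvent_conj (blockScale_mul_blockScale hs hiso (mul_inv_cancel₀ hr'))
    (blockScale_mul_blockScale hs hiso (inv_mul_cancel₀ hr'))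
    (resolvent_conj_add_I_smul hA hs hiso hQ hQ1 hκ hr hc hε hQε hεr hz hzs).1).1

/-- The circle of radius `r` around `μ + i` encloses a spectral subspace of `A + i Q` of the same
dimension as the eigenspace of `A` for `μ`: the Riesz projection of the conjugated operator is close
to that of the block diagonal model, which is the spectral projection of `A` for `μ`. -/
theorem circleEncloses_add_I_smul (hA : IsStarNormal A) (hs : s.Finite)
    (hiso : ∀ t ∈ s, ∀ᶠ w in 𝓝 t, w ∈ spectrum ℂ A → w = t) {Q : H →L[ℂ] H}
    (hQ : IsStarProjection Q) (hQ1 : ‖Q‖ ≤ 1) {κ : ℝ} (hκ : 1 < κ) {c ε r : ℝ} (hr : 0 < r)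
    (hc : c ^ 2 + (κ - 1)⁻¹ * c + c ≤ 1 / 4) (hε : 0 ≤ ε)
    (hQε : ‖(1 - Q) * specProj A s‖ ≤ ε) (hεr : ε ≤ c * √r) {μ : ℂ} (hμ : μ ∈ s)
    (hr1 : r < 1) (hrκ : r ≤ κ - 1)
    (hz : ∀ z ∈ Metric.closedBall (μ + Complex.I) r, ∀ t ∈ spectrum ℂ A, t ∉ s → κ ≤ ‖z - t‖)
    (hsep : ∀ t ∈ s, t ≠ μ → 2 * r ≤ ‖t - μ‖) :
    CircleEncloses (A + Complex.I • Q) (μ + Complex.I) r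
      (LinearMap.range (specProj A {μ}).toLinearMap) := by
  have hr' : ((√r : ℝ) : ℂ) ≠ 0 := by exact_mod_cast (Real.sqrt_pos.2 hr).ne'
  have hS1 := blockScale_mul_blockScale hs hiso (mul_inv_cancel₀ hr')
  have hS2 := blockScale_mul_blockScale hs hiso (inv_mul_cancel₀ hr')
  have hdist : ∀ z ∈ Metric.closedBall (μ + Complex.I) r, ∀ t ∈ s, t ≠ μ →
      r ≤ ‖z - (t + Complex.I)‖ := by
    intro z hzb t ht htμ
    rw [mem_closedBall_iff_norm] at hzb
    have h1 := hsep t ht htμ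
    have h2 : ‖t - μ‖ ≤ ‖z - (μ + Complex.I)‖ + ‖z - (t + Complex.I)‖ := by
      rw [show t - μ = (z - (μ + Complex.I)) - (z - (t + Complex.I)) by ring]
      exact norm_sub_le _ _
    linarith
  have main : ∀ z ∈ Metric.sphere (μ + Complex.I) r, _ := fun z hzs =>
    resolvent_conj_add_I_smul hA hs hiso hQ hQ1 hκ hr hc hε hQε hεr
      (hz z (Metric.sphere_subset_closedBall hzs)) (fun t ht => by
        by_cases h : t = μ
        · rw [h]; exact (mem_sphere_iff_norm.1 hzs).ge
        · exact hdist z (Metric.sphere_subset_closedBall hzs) t ht h)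
  have hμα := shiftOn_of_mem hμ
  have hB0 : rieszProjection (blockOp A s (shiftOn s) Q) (μ + Complex.I) r = specProj A {μ} := by
    rw [← hμα]
    refine rieszProjection_blockOp hA hs hiso (fun t ht => shiftOn_of_notMem ht) hQ1 hκ hμ hr hr1
      (by rwa [hμα]) fun z hzb t ht h => ?_
    rw [hμα] at hzb
    rintro rfl
    have := hdist _ hzb t ht h
    rw [shiftOn_of_mem ht, sub_self, norm_zero] at this
    linarith
  have hPP : specProj A {μ} * specProj A {μ} = specProj A {μ} :=
    specProj_mul_self (Set.finite_singleton μ) fun t ht => hiso t (by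
      rw [Set.mem_singleton_iff.1 ht]; exact hμ)
  set B := blockScale A s ((√r : ℝ) : ℂ) * (A + Complex.I • Q) * blockScale A s ((√r : ℝ) : ℂ)⁻¹
    with hB
  set B0 := blockOp A s (shiftOn s) Q
  have hρ : Metric.sphere (μ + Complex.I) r ⊆ resolventSet ℂ B := fun z hzs => (main z hzs).1
  have hρ0 : Metric.sphere (μ + Complex.I) r ⊆ resolventSet ℂ B0 := fun z hzs => (main z hzs).2.1
  refine ⟨fun z hzs => (resolvent_conj hS1 hS2 (hρ hzs)).1, ?_⟩
  rw [rank_spectralSubspace_conj hS1 hS2 hr.le hρ, ← hB]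
  refine rank_range_eq_of_norm_sub_lt_one (rieszProjection_mul_self hr hρ) hPP ?_
  rw [← hB0, rieszProjection, rieszProjection, ← smul_sub,
    ← circleIntegral.integral_sub (circleIntegrable_resolvent hr.le hρ)
      (circleIntegrable_resolvent hr.le hρ0)]
  refine (circleIntegral.norm_two_pi_i_inv_smul_integral_le_of_norm_le_const hr.le
    fun z hzs => (main z hzs).2.2).trans_lt ?_
  have h1 : r * (κ - 1)⁻¹ ≤ 1 := by
    rw [← div_eq_mul_inv, div_le_one (by linarith)]; exact hrκ
  have h2 : r * r⁻¹ = 1 := mul_inv_cancel₀ hr.ne'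
  nlinarith

end

end Galerkin

namespace Galerkin

variable {H : Type*} [NormedAddCommGroup H] [InnerProductSpace ℂ H]

/-! ### Resolvents of unbounded operators -/

section

variable {T : H →ₗ.[ℂ] H}

theorem isResolventAt_resolventOp {z : ℂ} (hz : z ∈ resolventSetU T) :
    IsResolventAt T z (resolventOp T z) := by
  have hz' : ∃ R : H →L[ℂ] H, IsResolventAt T z R := hz
  rw [resolventOp, dif_pos hz']; exact hz'.choose_spec

theorem resolventOp_injective {z : ℂ} (hz : z ∈ resolventSetU T) {x : H}
    (hx : resolventOp T z x = 0) : x = 0 := by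
  obtain ⟨h, e⟩ := (isResolventAt_resolventOp hz).1 x
  rw [← e, show (⟨resolventOp T z x, h⟩ : T.domain) = 0 from Subtype.ext hx, hx,
    LinearPMap.map_zero, smul_zero, sub_zero]

theorem resolventOp_sub {z w : ℂ} (hz : z ∈ resolventSetU T) (hw : w ∈ resolventSetU T) :
    resolventOp T z - resolventOp T w = (z - w) • (resolventOp T z * resolventOp T w) := by
  ext x
  obtain ⟨h, e⟩ := (isResolventAt_resolventOp hw).1 x
  have h2 := (isResolventAt_resolventOp hz).2 ⟨_, h⟩
  have h3 : resolventOp T z x = resolventOp T w x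
      + (z - w) • resolventOp T z (resolventOp T w x) := by
    have e' : x = (T ⟨_, h⟩ - z • resolventOp T w x) + (z - w) • resolventOp T w x := by
      conv_lhs => rw [← e]
      rw [sub_smul]; abel
    conv_lhs => rw [e']
    rw [map_add, map_smul, h2]
  change resolventOp T z x - resolventOp T w x = _
  rw [sub_eq_iff_eq_add', h3]; rfl

theorem resolventOp_commute {z w : ℂ} (hz : z ∈ resolventSetU T) (hw : w ∈ resolventSetU T) :
    Commute (resolventOp T z) (resolventOp T w) := by
  by_cases h : z = w
  · rw [h]
  · have h1 := resolventOp_sub hz hw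
    have h2 := resolventOp_sub hw hz
    rw [← neg_sub, h1, ← neg_sub z w, neg_smul, neg_inj] at h2
    exact smul_right_injective _ (sub_ne_zero.2 h) h2

/-- The spectral mapping theorem for resolvents. -/
theorem mem_resolventSet_resolventOp {z t : ℂ} (hz : z ∈ resolventSetU T) (ht : t ≠ 0)
    (hw : z + t⁻¹ ∈ resolventSetU T) : t ∈ resolventSet ℂ (resolventOp T z) := by
  have h1 := resolventOp_sub hz hw
  have hcomm := resolventOp_commute hz hw
  rw [sub_add_cancel_left] at h1
  set A := resolventOp T z
  set R := resolventOp T (z + t⁻¹)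
  have hA : A = R - t⁻¹ • (A * R) := by
    rw [sub_eq_iff_eq_add] at h1; rw [neg_smul] at h1
    rw [sub_eq_add_neg, add_comm]; exact h1
  have key : t⁻¹ • R - t⁻¹ • A - t⁻¹ • t⁻¹ • (A * R) = 0 := by
    rw [← smul_sub, ← smul_sub, sub_right_comm, ← hA, sub_self, smul_zero]
  have e1 : (algebraMap ℂ (H →L[ℂ] H) t - A) * (t⁻¹ • (1 + t⁻¹ • R)) = 1 := by
    rw [Algebra.algebraMap_eq_smul_one]
    calc _ = 1 + (t⁻¹ • R - t⁻¹ • A - t⁻¹ • t⁻¹ • (A * R)) := by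
          simp only [sub_mul, mul_add, mul_smul_comm, smul_mul_assoc, one_mul, mul_one, smul_add,
            smul_sub, inv_smul_smul₀ ht]
          abel
      _ = 1 := by rw [key, add_zero]
  have e2 : (t⁻¹ • (1 + t⁻¹ • R)) * (algebraMap ℂ (H →L[ℂ] H) t - A) = 1 := by
    have hc : Commute (algebraMap ℂ (H →L[ℂ] H) t - A) (t⁻¹ • (1 + t⁻¹ • R)) :=
      ((Algebra.commute_algebraMap_left _ _).sub_left
        (((Commute.one_right _).add_right (hcomm.smul_right _)).smul_right _))
    rw [← hc.eq, e1]
  exact (resolvent_eq_of_mul_eq_one e2 e1).1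

theorem mem_eigenspaceU_iff {z l : ℂ} (hz : z ∈ resolventSetU T) (hl : l - z ≠ 0) (x : H) :
    x ∈ eigenspaceU T l ↔ resolventOp T z x = (l - z)⁻¹ • x := by
  have hR := isResolventAt_resolventOp hz
  constructor
  · rintro ⟨y, hy, rfl⟩
    have hy' : T y = l • (y : H) := by
      have : T y - l • (y : H) = 0 := hy
      exact sub_eq_zero.1 this
    have h := hR.2 y
    rw [hy', ← sub_smul, map_smul] at h
    rw [eq_inv_smul_iff₀ hl]; exact h
  · intro h
    have hx : x = (l - z) • resolventOp T z x := by rw [h, smul_inv_smul₀ hl]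
    obtain ⟨hd, e⟩ := hR.1 x
    refine ⟨(l - z) • ⟨_, hd⟩, ?_, hx.symm⟩
    change T ((l - z) • ⟨_, hd⟩) - l • ((l - z) • resolventOp T z x) = 0
    rw [LinearPMap.map_smul, smul_comm, ← smul_sub]
    conv_rhs => rw [← smul_zero (l - z)]
    congr 1
    rw [sub_eq_iff_eq_add] at e
    rw [e]
    conv_lhs => enter [1, 1]; rw [hx]
    rw [sub_smul]; abel

variable [CompleteSpace H]

theorem isSelfAdjoint_resolventOp (hT : IsSelfAdjoint T) {c : ℝ}
    (hc : (c : ℂ) ∈ resolventSetU T) : IsSelfAdjoint (resolventOp T (c : ℂ)) := by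
  rw [ContinuousLinearMap.isSelfAdjoint_iff_isSymmetric]
  intro x y
  have hsymm := LinearPMap.adjoint_isFormalAdjoint hT.dense_domain
  rw [LinearPMap.isSelfAdjoint_def.1 hT] at hsymm
  obtain ⟨hx, ex⟩ := (isResolventAt_resolventOp hc).1 x
  obtain ⟨hy, ey⟩ := (isResolventAt_resolventOp hc).1 y
  have h := hsymm ⟨_, hx⟩ ⟨_, hy⟩
  change inner ℂ (resolventOp T c x) y = inner ℂ x (resolventOp T c y)
  conv_lhs => enter [3]; rw [← ey]
  conv_rhs => enter [2]; rw [← ex]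
  rw [inner_sub_left, inner_sub_right, inner_smul_left, inner_smul_right, h, Complex.conj_ofReal]

/-- The resolvent is nonnegative at every point to the left of the spectrum. -/
theorem resolventOp_nonneg (hT : IsSelfAdjoint T) {m c : ℝ}
    (hm : ∀ l : ℝ, l < m → (l : ℂ) ∈ resolventSetU T) (hc : c < m) :
    0 ≤ resolventOp T (c : ℂ) := by
  rw [StarOrderedRing.nonneg_iff_spectrum_nonneg (R := ℝ) _
    (isSelfAdjoint_resolventOp hT (hm c hc))]
  intro t ht
  by_contra hneg
  rw [not_le] at hneg
  have h := spectrum.algebraMap_mem ℂ ht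
  refine h (mem_resolventSet_resolventOp (hm c hc) ?_ ?_)
  · simpa using hneg.ne
  · have := hm (c + t⁻¹) (by have := inv_lt_zero.2 hneg; linarith)
    simpa using this

/-! ### Square roots of resolvents -/

/-- The bounded operator `(T - c)^{-1/2}`. -/
noncomputable def sqrtResolvent (T : H →ₗ.[ℂ] H) (c : ℝ) : H →L[ℂ] H :=
  CFC.sqrt (resolventOp T (c : ℂ))

theorem sqrtResolvent_mul_self (hT : IsSelfAdjoint T) {m c : ℝ}
    (hm : ∀ l : ℝ, l < m → (l : ℂ) ∈ resolventSetU T) (hc : c < m) :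
    sqrtResolvent T c * sqrtResolvent T c = resolventOp T (c : ℂ) :=
  CFC.sqrt_mul_sqrt_self _ (resolventOp_nonneg hT hm hc)

theorem isSelfAdjoint_sqrtResolvent (T : H →ₗ.[ℂ] H) (c : ℝ) :
    IsSelfAdjoint (sqrtResolvent T c) := (CFC.sqrt_nonneg _).isSelfAdjoint

theorem sqrtResolvent_injective (hT : IsSelfAdjoint T) {m c : ℝ}
    (hm : ∀ l : ℝ, l < m → (l : ℂ) ∈ resolventSetU T) (hc : c < m) :
    Function.Injective (sqrtResolvent T c) := by
  refine (injective_iff_map_eq_zero _).2 fun x hx => resolventOp_injective (hm c hc) ?_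
  rw [← sqrtResolvent_mul_self hT hm hc, mul_apply_eq_comp, hx, map_zero]

theorem inner_sqrtResolvent (hT : IsSelfAdjoint T) {m c : ℝ}
    (hm : ∀ l : ℝ, l < m → (l : ℂ) ∈ resolventSetU T) (hc : c < m) (u v : H) :
    inner ℂ (sqrtResolvent T c u) (sqrtResolvent T c v) = inner ℂ u (resolventOp T (c : ℂ) v) := by
  rw [← sqrtResolvent_mul_self hT hm hc, mul_apply_eq_comp]
  exact (isSelfAdjoint_sqrtResolvent T c).isSymmetric u _

theorem mem_sqrtShift_domain {c : ℝ} {x : H} :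
    x ∈ (sqrtShift T c).domain ↔ ∃ u, sqrtResolvent T c u = x := by
  rw [sqrtShift, LinearPMap.inverse_domain]
  constructor
  · rintro ⟨u, rfl⟩; exact ⟨u, rfl⟩
  · rintro ⟨u, rfl⟩; exact ⟨⟨u, trivial⟩, rfl⟩

theorem sqrtShift_apply (hT : IsSelfAdjoint T) {m c : ℝ}
    (hm : ∀ l : ℝ, l < m → (l : ℂ) ∈ resolventSetU T) (hc : c < m)
    (x : (sqrtShift T c).domain) {u : H} (hu : sqrtResolvent T c u = x) : sqrtShift T c x = u := by
  refine LinearPMap.inverse_apply_eq (f := (sqrtResolvent T c).toLinearMap.toPMap ⊤)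
    ?_ (x := ⟨u, trivial⟩) hu
  rw [LinearMap.ker_eq_bot']
  intro v hv
  have hv' : sqrtResolvent T c v = 0 := hv
  exact Subtype.ext (sqrtResolvent_injective hT hm hc (hv'.trans (map_zero _).symm))

/-- The square roots of the resolvents at two points `c` and `d` differ by an invertible factor `K`,
namely `K = ((T - d) (T - c)⁻¹)^{1/2}`. -/
theorem exists_sqrtResolvent_eq_mul (hT : IsSelfAdjoint T) {m c d : ℝ}
    (hm : ∀ l : ℝ, l < m → (l : ℂ) ∈ resolventSetU T) (hc : c < m) (hd : d < m) :
    ∃ K K' : H →L[ℂ] H, K * K' = 1 ∧ K' * K = 1 ∧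
      sqrtResolvent T c = sqrtResolvent T d * K ∧
      ∀ u v, inner ℂ (K' u) (K' v) = inner ℂ u v
        + ((d - c : ℝ) : ℂ) * inner ℂ (sqrtResolvent T d u) (sqrtResolvent T d v) := by
  have hA0 := resolventOp_nonneg hT hm hd
  have hC0 := resolventOp_nonneg hT hm hc
  have hsub := resolventOp_sub (hm d hd) (hm c hc)
  have hcomm := (resolventOp_commute (hm d hd) (hm c hc))
  have hinner := inner_sqrtResolvent hT hm hd
  have hR0 : 0 ≤ sqrtResolvent T d := CFC.sqrt_nonneg _
  have hRR := sqrtResolvent_mul_self hT hm hd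
  rw [sqrtResolvent]
  set R := sqrtResolvent T d with hRdef
  set A := resolventOp T (d : ℂ) with hA
  set C := resolventOp T (c : ℂ)
  set e : ℝ := d - c with he
  have hsub' : A - C = (e : ℂ) • (A * C) := by rw [hsub, he]; push_cast; rfl
  set V : H →L[ℂ] H := 1 + (e : ℂ) • A with hV
  set W : H →L[ℂ] H := 1 - (e : ℂ) • C with hW
  have hVW : V * W = 1 := by
    have : V * W = 1 + (e : ℂ) • (A - C - (e : ℂ) • (A * C)) := by
      rw [hV, hW]
      simp only [add_mul, mul_sub, smul_mul_assoc, mul_smul_comm, one_mul, mul_one, smul_sub,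
        smul_add]
      abel
    rw [this, hsub', sub_self, smul_zero, add_zero]
  have hVWc : Commute V W :=
    ((Commute.one_left _).add_left (Commute.smul_left ((Commute.one_right _).sub_right
      (hcomm.smul_right _)) _))
  have hWV : W * V = 1 := by rw [← hVWc.eq, hVW]
  have hAW : A * W = C := by
    rw [hW, mul_sub, mul_one, mul_smul_comm, ← hsub']; abel
  have hVsa : IsSelfAdjoint V := by
    refine (IsSelfAdjoint.one _).add ?_
    rw [IsSelfAdjoint, star_smul, hA0.isSelfAdjoint.star_eq]; simp
  have hWsa : IsSelfAdjoint W := by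
    refine (IsSelfAdjoint.one _).sub ?_
    rw [IsSelfAdjoint, star_smul, hC0.isSelfAdjoint.star_eq]; simp
  have hreal : ∀ (a : ℝ) (B : H →L[ℂ] H), (a : ℂ) • B = a • B := fun a B => by
    ext x; simp
  -- depending on the sign of `e`, one of `V` and `W = V⁻¹` is obviously nonnegative
  have hW0 : 0 ≤ W := by
    rcases le_total 0 e with h | h
    · have hV0 : 0 ≤ V := by
        rw [hV, hreal]
        exact add_nonneg zero_le_one (smul_nonneg h hA0)
      have := hWsa.conjugate_nonneg hV0
      rwa [hWV, one_mul] at this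
    · rw [hW, hreal, sub_eq_add_neg, ← neg_smul]
      exact add_nonneg zero_le_one (smul_nonneg (by linarith) hC0)
  set K := CFC.sqrt W with hK
  have hK0 : 0 ≤ K := CFC.sqrt_nonneg _
  have hKK : K * K = W := CFC.sqrt_mul_sqrt_self W hW0
  have hKW : Commute K W := by rw [← hKK]; exact (Commute.refl K).mul_right (Commute.refl K)
  have hKV : K * V = V * K := by
    calc K * V = (V * W) * K * V := by rw [hVW, one_mul]
      _ = V * (W * K) * V := by rw [mul_assoc V]
      _ = V * K * (W * V) := by rw [← hKW.eq]; noncomm_ring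
      _ = V * K := by rw [hWV, mul_one]
  have hAWc : Commute A W := (Commute.one_right _).sub_right (hcomm.smul_right _)
  have hRK : Commute R K := by
    have h1 : Commute R W := Commute.cfcₙ_nnreal hAWc _
    exact (Commute.cfcₙ_nnreal h1.symm _).symm
  refine ⟨K, V * K, ?_, ?_, ?_, fun u v => ?_⟩
  · rw [← mul_assoc, hKV, mul_assoc, hKK, hVW]
  · rw [mul_assoc, hKK, hVW]
  · refine CFC.sqrt_unique ?_ (hRK.mul_nonneg hR0 hK0)
    calc R * K * (R * K) = R * (K * R) * K := by noncomm_ring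
      _ = (R * R) * (K * K) := by rw [← hRK.eq]; noncomm_ring
      _ = C := by rw [hRR, hKK, hAW]
  · have hsa : IsSelfAdjoint (V * K) := by
      rw [IsSelfAdjoint, star_mul, hVsa.star_eq, hK0.isSelfAdjoint.star_eq, hKV]
    have h1 : (V * K) * (V * K) = V := by
      calc V * K * (V * K) = V * (K * V) * K := by noncomm_ring
        _ = V * (V * (K * K)) := by rw [hKV]; noncomm_ring
        _ = V := by rw [hKK, hVW, mul_one]
    have h2 : inner ℂ ((V * K) u) ((V * K) v) = inner ℂ u (((V * K) * (V * K)) v) :=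
      hsa.isSymmetric u _
    rw [h2, h1, hinner, hV]
    change inner ℂ u (v + (e : ℂ) • A v) = _
    rw [inner_add_right, inner_smul_right]

end

end Galerkin

namespace Galerkin

variable {H : Type*} [NormedAddCommGroup H] [InnerProductSpace ℂ H]

/-! ### The form norm and the gap -/

section

theorem finiteDimensional_comap {f : H →L[ℂ] H} (hf : Function.Injective f) (L : Submodule ℂ H)
    [FiniteDimensional ℂ L] : FiniteDimensional ℂ (L.comap f.toLinearMap) :=
  FiniteDimensional.of_injective
    (f.toLinearMap.restrict (p := L.comap f.toLinearMap) (q := L) fun _ hx => hx)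
    fun _ _ hxy => Subtype.ext (hf (congrArg Subtype.val hxy))

theorem norm_sub_starProjection_le (M : Submodule ℂ H) [M.HasOrthogonalProjection] (x : H) {y : H}
    (hy : y ∈ M) : ‖x - M.starProjection x‖ ≤ ‖x - y‖ := by
  rw [Submodule.starProjection_minimal]
  exact ciInf_le ⟨0, by rintro _ ⟨w, rfl⟩; exact norm_nonneg _⟩ (⟨y, hy⟩ : M)

variable [CompleteSpace H] {T : H →ₗ.[ℂ] H} {m : ℝ}

theorem mem_formDomain {x : H} : x ∈ formDomain T m ↔ ∃ u, sqrtResolvent T (m - 1) u = x :=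
  mem_sqrtShift_domain

theorem formNorm_eq (hT : IsSelfAdjoint T) (hm : ∀ l : ℝ, l < m → (l : ℂ) ∈ resolventSetU T)
    (x : formDomain T m) {u : H} (hu : sqrtResolvent T (m - 1) u = x) :
    formNorm T m x = ‖u‖ := by
  have hS : sqrtShift T (m - 1) x = u := sqrtShift_apply hT hm (by linarith) x hu
  rw [formNorm, form, hS, inner_self_eq_norm_sq_to_K, inner_self_eq_norm_sq_to_K]
  have h1 : ((‖u‖ : ℂ) ^ 2 + ((m - 1 : ℝ) : ℂ) * (‖(x : H)‖ : ℂ) ^ 2).re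
      = ‖u‖ ^ 2 + (m - 1) * ‖(x : H)‖ ^ 2 := by norm_cast
  have h2 : ((‖u‖ : ℂ) ^ 2 + ((m - 1 : ℝ) : ℂ) * (‖(x : H)‖ : ℂ) ^ 2).re
      - m * ‖(x : H)‖ ^ 2 + ‖(x : H)‖ ^ 2 = ‖u‖ ^ 2 := by rw [h1]; ring
  exact (congrArg Real.sqrt h2).trans (Real.sqrt_sq (norm_nonneg u))

theorem formDist_eq (hT : IsSelfAdjoint T) (hm : ∀ l : ℝ, l < m → (l : ℂ) ∈ resolventSetU T)
    (L : Submodule ℂ H) [((L.comap (sqrtResolvent T (m - 1)).toLinearMap)).HasOrthogonalProjection]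
    (x : formDomain T m) {u : H} (hu : sqrtResolvent T (m - 1) u = x) :
    formDist T m x L
      = ‖u - (L.comap (sqrtResolvent T (m - 1)).toLinearMap).starProjection u‖ := by
  set M := L.comap (sqrtResolvent T (m - 1)).toLinearMap with hM
  apply le_antisymm
  · have hP : M.starProjection u ∈ M := Submodule.starProjection_apply_mem M u
    let y : formDomain T m :=
      ⟨sqrtResolvent T (m - 1) (M.starProjection u), mem_formDomain.2 ⟨_, rfl⟩⟩
    refine (ciInf_le ⟨0, ?_⟩ (⟨y, hP⟩ : {y : formDomain T m // (y : H) ∈ L})).trans_eq ?_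
    · rintro _ ⟨w, rfl⟩; exact Real.sqrt_nonneg _
    · refine formNorm_eq hT hm _ ?_
      rw [map_sub, hu]; rfl
  · have : Nonempty {y : formDomain T m // (y : H) ∈ L} := ⟨⟨0, L.zero_mem⟩⟩
    refine le_ciInf fun y => ?_
    obtain ⟨v, hv⟩ := mem_formDomain.1 y.1.2
    have hvM : v ∈ M := by
      change sqrtResolvent T (m - 1) v ∈ L
      rw [hv]; exact y.2
    rw [formNorm_eq hT hm (x - y.1) (u := u - v) (by rw [map_sub, hu, hv]; rfl)]
    exact norm_sub_starProjection_le M u hvM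

theorem formDist_nonneg (x : formDomain T m) (L : Submodule ℂ H) : 0 ≤ formDist T m x L :=
  Real.iInf_nonneg fun _ => Real.sqrt_nonneg _

theorem formGap_nonneg (N L : Submodule ℂ H) : 0 ≤ formGap T m N L :=
  Real.iSup_nonneg fun x => formDist_nonneg x.1 L

theorem norm_sub_starProjection_le_formGap (hT : IsSelfAdjoint T)
    (hm : ∀ l : ℝ, l < m → (l : ℂ) ∈ resolventSetU T) (N L : Submodule ℂ H)
    [((L.comap (sqrtResolvent T (m - 1)).toLinearMap)).HasOrthogonalProjection]
    {u : H} (hu : sqrtResolvent T (m - 1) u ∈ N) :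
    ‖u - (L.comap (sqrtResolvent T (m - 1)).toLinearMap).starProjection u‖
      ≤ formGap T m N L * ‖u‖ := by
  set M := L.comap (sqrtResolvent T (m - 1)).toLinearMap with hM
  by_cases h0 : u = 0
  · simp [h0]
  have hpos : 0 < ‖u‖ := norm_pos_iff.2 h0
  set k : ℂ := (‖u‖ : ℂ)⁻¹ with hk
  have hkn : ‖k‖ = ‖u‖⁻¹ := by simp [hk]
  let x : formDomain T m := ⟨sqrtResolvent T (m - 1) (k • u), mem_formDomain.2 ⟨_, rfl⟩⟩
  have hxN : (x : H) ∈ N := by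
    change sqrtResolvent T (m - 1) (k • u) ∈ N
    rw [map_smul]; exact N.smul_mem _ hu
  have hx1 : formNorm T m x = 1 := by
    rw [formNorm_eq hT hm x (u := k • u) rfl, norm_smul, hkn, inv_mul_cancel₀ hpos.ne']
  have hbdd : BddAbove (Set.range fun x : {x : formDomain T m // (x : H) ∈ N ∧
      formNorm T m x = 1} => formDist T m x.1 L) := by
    refine ⟨1, ?_⟩
    rintro _ ⟨w, rfl⟩
    obtain ⟨v, hv⟩ := mem_formDomain.1 w.1.2
    have hv1 : ‖v‖ = 1 := by rw [← formNorm_eq hT hm w.1 hv, w.2.2]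
    simp only [formDist_eq hT hm L w.1 hv]
    refine (norm_sub_starProjection_le _ v (Submodule.zero_mem _)).trans ?_
    rw [sub_zero, hv1]
  have h := le_ciSup hbdd ⟨x, hxN, hx1⟩
  simp only [formDist_eq hT hm L x (u := k • u) rfl, map_smul, ← smul_sub, norm_smul, hkn] at h
  rw [inv_mul_le_iff₀ hpos, mul_comm] at h
  exact h

/-- If the trial spaces are dense in the form domain, then the gap to a fixed finite dimensional
space tends to zero: strong convergence of projections is uniform on finite dimensional spaces. -/
theorem tendsto_formGap (hT : IsSelfAdjoint T)
    (hm : ∀ l : ℝ, l < m → (l : ℂ) ∈ resolventSetU T) (N : Submodule ℂ H) [FiniteDimensional ℂ N]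
    (L : ℕ → Submodule ℂ H) [∀ n, FiniteDimensional ℂ (L n)]
    (hdense : ∀ x : formDomain T m, ∃ y : ℕ → formDomain T m,
      (∀ n, (y n : H) ∈ L n) ∧ Tendsto (fun n => formNorm T m (x - y n)) atTop (𝓝 0)) :
    Tendsto (fun n => formGap T m N (L n)) atTop (𝓝 0) := by
  set R := sqrtResolvent T (m - 1) with hR
  have hinj : Function.Injective R := sqrtResolvent_injective hT hm (by linarith)
  have := finiteDimensional_comap hinj N
  have := fun n => finiteDimensional_comap hinj (L n)
  let P : ℕ → H →L[ℂ] H := fun n => ((L n).comap R.toLinearMap).starProjection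
  have hP : ∀ u, Tendsto (fun n => ‖u - P n u‖) atTop (𝓝 0) := by
    intro u
    obtain ⟨y, hyL, hy⟩ := hdense ⟨R u, mem_formDomain.2 ⟨u, rfl⟩⟩
    refine squeeze_zero (fun _ => norm_nonneg _) (fun n => ?_) hy
    obtain ⟨v, hv⟩ := mem_formDomain.1 (y n).2
    rw [formNorm_eq hT hm (⟨R u, mem_formDomain.2 ⟨u, rfl⟩⟩ - y n) (u := u - v)
      (by rw [map_sub, hv]; rfl)]
    refine norm_sub_starProjection_le _ u ?_
    change R v ∈ L n
    rw [hv]; exact hyL n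
  let e := stdOrthonormalBasis ℂ (N.comap R.toLinearMap)
  have hsum : Tendsto (fun n => ∑ i, ‖(e i : H) - P n (e i)‖) atTop (𝓝 0) := by
    simpa using tendsto_finsetSum Finset.univ fun i _ => hP (e i)
  refine squeeze_zero (fun n => formGap_nonneg N (L n)) (fun n => ?_) hsum
  refine Real.iSup_le (fun x => ?_) (Finset.sum_nonneg fun _ _ => norm_nonneg _)
  obtain ⟨u, hu⟩ := mem_formDomain.1 x.1.2
  have hu1 : ‖u‖ = 1 := by rw [← formNorm_eq hT hm x.1 hu, x.2.2]
  have huN : u ∈ N.comap R.toLinearMap := by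
    change R u ∈ N
    rw [hu]; exact x.2.1
  rw [formDist_eq hT hm (L n) x.1 hu]
  have hrepr : u = ∑ i, inner ℂ (e i : H) u • (e i : H) := by
    have := congrArg Subtype.val (e.sum_repr' ⟨u, huN⟩)
    simpa using this.symm
  change ‖u - P n u‖ ≤ _
  calc ‖u - P n u‖ = ‖∑ i, inner ℂ (e i : H) u • ((e i : H) - P n (e i))‖ := by
        congr 1
        conv_lhs => rw [hrepr]
        simp only [map_sum, map_smul, smul_sub, Finset.sum_sub_distrib]
    _ ≤ ∑ i, ‖inner ℂ (e i : H) u • ((e i : H) - P n (e i))‖ := norm_sum_le _ _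
    _ ≤ ∑ i, ‖(e i : H) - P n (e i)‖ := by
        refine Finset.sum_le_sum fun i _ => ?_
        rw [norm_smul]
        refine mul_le_of_le_one_left (norm_nonneg _) ((norm_inner_le_norm _ _).trans ?_)
        rw [hu1, mul_one]
        exact (e.norm_eq_one i).le

end

/-! ### Galerkin eigenvectors -/

section

variable [CompleteSpace H]

/-- An eigenvector `e` of `A` is approximated by the span `Y` of the eigenvectors of the compression
of `A` to `M`, for eigenvalues in `[p, q]`, up to a multiple of its distance from `M`: the
components of the projection of `e` to `M` for eigenvalues off `[p, q]` are controlled by the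
residual. -/
theorem norm_sub_starProjection_le_of_eigenvector {A : H →L[ℂ] H} (hA : IsSelfAdjoint A)
    (M Y : Submodule ℂ H) [FiniteDimensional ℂ M] [Y.HasOrthogonalProjection] {p q η μ : ℝ}
    (hη : 0 < η) (hp : p + η ≤ μ) (hq : μ + η ≤ q)
    (hY : ∀ u ∈ M, ∀ ν ∈ Set.Icc p q, (∀ v ∈ M, inner ℂ v (A u) = (ν : ℂ) * inner ℂ v u) → u ∈ Y)
    {e : H} (he : A e = (μ : ℂ) • e) :
    ‖e - Y.starProjection e‖ ≤ (1 + ‖A‖ / η) * ‖e - M.starProjection e‖ := by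
  classical
  let B : M →ₗ[ℂ] M := M.orthogonalProjectionOnto.toLinearMap ∘ₗ A.toLinearMap ∘ₗ M.subtype
  have hBinner : ∀ v u : M, inner ℂ v (B u) = inner ℂ (v : H) (A u) := fun v u =>
    Submodule.inner_orthogonalProjectionOnto_eq_of_mem_left v (A u)
  have hB : B.IsSymmetric := fun u v => by
    rw [hBinner, ← inner_conj_symm, hBinner, inner_conj_symm]
    exact hA.isSymmetric u v
  let b := hB.eigenvectorBasis rfl
  let ν := hB.eigenvalues rfl
  have hb : ∀ i, B (b i) = (ν i : ℂ) • b i := fun i => hB.apply_eigenvectorBasis rfl i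
  let w : M := M.orthogonalProjectionOnto e
  have hw : (w : H) = M.starProjection e := rfl
  let y : M := ∑ i, (if ν i ∈ Set.Icc p q then inner ℂ (b i) w else 0) • b i
  have hyY : (y : H) ∈ Y := by
    simp only [y, Submodule.coe_sum, Submodule.coe_smul]
    refine Y.sum_mem fun i _ => ?_
    split_ifs with h
    · refine Y.smul_mem _ (hY _ (b i).2 _ h fun v hv => ?_)
      rw [← hBinner ⟨v, hv⟩ (b i), hb, inner_smul_right]; rfl
    · simp
  have hcoord : ∀ i, ‖inner ℂ (b i) (w - y)‖ ^ 2 ≤ η⁻¹ ^ 2 * ‖inner ℂ (b i) (B w - (μ : ℂ) • w)‖ ^ 2 := by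
    intro i
    have h1 : inner ℂ (b i) (B w - (μ : ℂ) • w) = ((ν i - μ : ℝ) : ℂ) * inner ℂ (b i) w := by
      rw [inner_sub_right, ← hB (b i) w, hb, inner_smul_left, inner_smul_right, Complex.conj_ofReal]
      push_cast; ring
    have h2 : inner ℂ (b i) y = if ν i ∈ Set.Icc p q then inner ℂ (b i) w else 0 := by
      simp only [y, inner_sum, inner_smul_right, orthonormal_iff_ite.1 b.orthonormal]
      simp
    rw [← mul_pow, inner_sub_right, h2, h1]
    refine pow_le_pow_left₀ (norm_nonneg _) ?_ 2
    split_ifs with h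
    · rw [sub_self, norm_zero]; positivity
    · rw [sub_zero, norm_mul, Complex.norm_real, Real.norm_eq_abs, ← mul_assoc]
      refine le_mul_of_one_le_left (norm_nonneg _) ?_
      rw [← div_eq_inv_mul, one_le_div hη]
      rw [Set.mem_Icc, not_and_or, not_le, not_le] at h
      rcases h with h | h
      · rw [abs_of_neg (by linarith)]; linarith
      · rw [abs_of_pos (by linarith)]; linarith
  have hwy : ‖w - y‖ ≤ η⁻¹ * ‖B w - (μ : ℂ) • w‖ := by
    refine le_of_sq_le_sq ?_ (by positivity)
    rw [mul_pow, ← b.sum_sq_norm_inner_right, ← b.sum_sq_norm_inner_right, Finset.mul_sum]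
    exact Finset.sum_le_sum fun i _ => hcoord i
  have hres : ‖B w - (μ : ℂ) • w‖ ≤ ‖A‖ * ‖e - M.starProjection e‖ := by
    have : B w - (μ : ℂ) • w = M.orthogonalProjectionOnto (A (w - e)) := by
      rw [map_sub, map_sub, he, map_smul]; rfl
    rw [this]
    refine (Submodule.norm_orthogonalProjectionOnto_apply_le M _).trans ((A.le_opNorm _).trans_eq ?_)
    rw [hw, norm_sub_rev]
  calc ‖e - Y.starProjection e‖ ≤ ‖e - y‖ := norm_sub_starProjection_le Y e hyY
    _ = ‖(e - M.starProjection e) + ((w - y : M) : H)‖ := by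
        congr 1; rw [Submodule.coe_sub, hw]; abel
    _ ≤ ‖e - M.starProjection e‖ + ‖w - y‖ := norm_add_le _ _
    _ ≤ ‖e - M.starProjection e‖ + η⁻¹ * (‖A‖ * ‖e - M.starProjection e‖) := by
        gcongr
        exact hwy.trans (mul_le_mul_of_nonneg_left hres (by positivity))
    _ = _ := by rw [div_eq_mul_inv]; ring

variable {T : H →ₗ.[ℂ] H} {m : ℝ}

/-- The form in terms of `(T - γ)^{1/2}`. -/
theorem form_eq (hT : IsSelfAdjoint T) (hm : ∀ l : ℝ, l < m → (l : ℂ) ∈ resolventSetU T)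
    {γ : ℝ} (hγ : γ < m) (x y : formDomain T m) {u v : H} (hu : sqrtResolvent T γ u = x)
    (hv : sqrtResolvent T γ v = y) :
    form T m x y = inner ℂ v u + (γ : ℂ) * inner ℂ (y : H) (x : H) := by
  obtain ⟨K, K', h1, -, hR, hK⟩ :=
    exists_sqrtResolvent_eq_mul hT hm (show m - 1 < m by linarith) hγ
  have hS : ∀ (z : formDomain T m) (w : H), sqrtResolvent T γ w = z →
      sqrtShift T (m - 1) z = K' w := fun z w hw => by
    refine sqrtShift_apply hT hm (by linarith) z ?_
    rw [hR]
    change sqrtResolvent T γ ((K * K') w) = z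
    rw [h1]; exact hw
  rw [form, hS x u hu, hS y v hv, hK, hu, hv]
  push_cast; ring

/-- Eigenvectors of the compression of `(T - γ)⁻¹` to `(T - γ)^{1/2} L` come from Galerkin
eigenvectors of `T`: the eigenvalue `ν` corresponds to `γ + 1 / ν`. -/
theorem mem_transformedSpan (hT : IsSelfAdjoint T)
    (hm : ∀ l : ℝ, l < m → (l : ℂ) ∈ resolventSetU T) {γ : ℝ} (hγ : γ < m) {a b : ℝ} (hγa : γ < a)
    (L : Submodule ℂ H) (hL : L ≤ formDomain T m) {u : H} (hu : sqrtResolvent T γ u ∈ L) {ν : ℝ}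
    (hν : ν ∈ Set.Icc (1 / (b - γ)) (1 / (a - γ))) (hab : a < b)
    (h : ∀ v, sqrtResolvent T γ v ∈ L →
      inner ℂ v (resolventOp T (γ : ℂ) u) = (ν : ℂ) * inner ℂ v u) :
    u ∈ transformedSpan T m γ a b L := by
  set R := sqrtResolvent T γ with hR
  have hν0 : 0 < ν := lt_of_lt_of_le (by have : 0 < b - γ := by linarith
                                         positivity) hν.1
  have hgal : R u ∈ galerkinSpan T m a b L := by
    refine Submodule.subset_span ⟨⟨R u, hL hu⟩, rfl, hu, γ + 1 / ν, ⟨?_, ?_⟩, fun v hv => ?_⟩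
    · have := (le_one_div hν0 (by linarith)).1 hν.2
      linarith
    · have := (one_div_le (by linarith) hν0).1 hν.1
      linarith
    · obtain ⟨w, hw⟩ : ∃ w, R w = v := by
        obtain ⟨K, K', h1, h2, hRK, -⟩ :=
          exists_sqrtResolvent_eq_mul hT hm (show m - 1 < m by linarith) hγ
        obtain ⟨w, hw⟩ := mem_formDomain.1 v.2
        exact ⟨K w, by rw [← hw, hRK]; rfl⟩
      have hwL : R w ∈ L := by rw [hw]; exact hv
      have h' := h w hwL
      rw [← inner_sqrtResolvent hT hm hγ] at h'
      rw [form_eq hT hm hγ _ v (u := u) rfl hw, ← hw]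
      change _ + _ * inner ℂ (R w) (R u) = _ * inner ℂ (R w) (R u)
      rw [h']
      have : (ν : ℂ) ≠ 0 := by exact_mod_cast hν0.ne'
      push_cast
      field_simp
      ring
  refine ⟨⟨R u, mem_sqrtShift_domain.2 ⟨u, rfl⟩⟩, hgal, ?_⟩
  exact sqrtShift_apply hT hm hγ _ rfl

/-- Eigenvectors of `T` are approximated by the transformed trial spaces at the rate of the gap. -/
theorem exists_norm_sub_starProjection_le (hT : IsSelfAdjoint T)
    (hm : ∀ l : ℝ, l < m → (l : ℂ) ∈ resolventSetU T) {γ : ℝ} (hγ : γ < m) (N : Submodule ℂ H) :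
    ∃ C : ℝ, 0 ≤ C ∧ ∀ (L : Submodule ℂ H) [FiniteDimensional ℂ L]
      [(L.comap (sqrtResolvent T γ).toLinearMap).HasOrthogonalProjection] (e : H),
      sqrtResolvent T γ e ∈ N →
      ‖e - (L.comap (sqrtResolvent T γ).toLinearMap).starProjection e‖
        ≤ C * formGap T m N L * ‖e‖ := by
  obtain ⟨K, K', h1, -, hR, -⟩ :=
    exists_sqrtResolvent_eq_mul hT hm (show m - 1 < m by linarith) hγ
  refine ⟨‖K‖ * ‖K'‖, by positivity, fun L _ _ e he => ?_⟩
  have hinj : Function.Injective (sqrtResolvent T (m - 1)) :=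
    sqrtResolvent_injective hT hm (by linarith)
  have := finiteDimensional_comap hinj L
  have hKK : ∀ x, K (K' x) = x := fun x => congrArg (fun S : H →L[ℂ] H => S x) h1
  have hR1 : ∀ x, sqrtResolvent T (m - 1) x = sqrtResolvent T γ (K x) := fun x => by rw [hR]; rfl
  have hgap := norm_sub_starProjection_le_formGap hT hm N L (u := K' e) (by rwa [hR1, hKK])
  set P := (L.comap (sqrtResolvent T (m - 1)).toLinearMap).starProjection
  have hP : P (K' e) ∈ L.comap (sqrtResolvent T (m - 1)).toLinearMap :=
    Submodule.starProjection_apply_mem _ _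
  have hP' : K (P (K' e)) ∈ L.comap (sqrtResolvent T γ).toLinearMap := by
    change sqrtResolvent T γ (K (P (K' e))) ∈ L
    rw [← hR1]; exact hP
  calc _ ≤ ‖e - K (P (K' e))‖ := norm_sub_starProjection_le _ e hP'
    _ = ‖K (K' e - P (K' e))‖ := by rw [map_sub, hKK]
    _ ≤ ‖K‖ * ‖K' e - P (K' e)‖ := K.le_opNorm _
    _ ≤ ‖K‖ * (formGap T m N L * (‖K'‖ * ‖e‖)) := by
        have := formGap_nonneg (T := T) (m := m) N L
        gcongr
        exact hgap.trans (mul_le_mul_of_nonneg_left (K'.le_opNorm e) this)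
    _ = _ := by ring

end

end Galerkin

namespace Galerkin

variable {H : Type*} [NormedAddCommGroup H] [InnerProductSpace ℂ H]

/-! ### The spectrum of the resolvent in the transformed interval -/

/-- The image of `σ(T) ∩ [a, b]` under `l ↦ 1 / (l - γ)`. -/
def transformedSpec (T : H →ₗ.[ℂ] H) (γ a b : ℝ) : Set ℂ :=
  (fun l : ℝ => ((1 / (l - γ) : ℝ) : ℂ)) '' {l | l ∈ Set.Icc a b ∧ (l : ℂ) ∈ spectrumU T}

section

variable {T : H →ₗ.[ℂ] H} {γ a b : ℝ}

theorem eigenspaceU_eq_bot {l : ℂ} (hl : l ∈ resolventSetU T) : eigenspaceU T l = ⊥ := by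
  rw [eq_bot_iff]
  rintro _ ⟨y, hy, rfl⟩
  have hy' : T y - l • (y : H) = 0 := hy
  have h := (isResolventAt_resolventOp hl).2 y
  rw [hy', map_zero] at h
  exact h.symm

/-- Nonzero spectral points of `(T - γ)⁻¹` come from spectral points of `T`. -/
theorem add_inv_mem_spectrumU (hγ : (γ : ℂ) ∈ resolventSetU T) {t : ℂ} (ht : t ≠ 0)
    (h : t ∈ spectrum ℂ (resolventOp T (γ : ℂ))) : (γ : ℂ) + t⁻¹ ∈ spectrumU T :=
  fun hw => h (mem_resolventSet_resolventOp hγ ht hw)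

theorem mem_transformedSpec (hγ : (γ : ℂ) ∈ resolventSetU T) (hγa : γ < a) (hab : a < b) {x : ℝ}
    (hx : x ∈ Set.Icc (1 / (b - γ)) (1 / (a - γ)))
    (h : (x : ℂ) ∈ spectrum ℂ (resolventOp T (γ : ℂ))) : (x : ℂ) ∈ transformedSpec T γ a b := by
  have hx0 : 0 < x := lt_of_lt_of_le (one_div_pos.2 (by linarith)) hx.1
  have hs := add_inv_mem_spectrumU hγ (t := (x : ℂ)) (by exact_mod_cast hx0.ne') h
  refine ⟨γ + 1 / x, ⟨⟨?_, ?_⟩, ?_⟩, ?_⟩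
  · have := (le_one_div hx0 (by linarith)).1 hx.2
    linarith
  · have := (one_div_le (by linarith) hx0).1 hx.1
    linarith
  · push_cast; simpa using hs
  · simp

theorem transformedSpec_subset_spectrum (hγ : (γ : ℂ) ∈ resolventSetU T) (hγa : γ < a)
    (hdis : ∀ l ∈ Set.Icc a b, (l : ℂ) ∈ spectrumU T → InDiscreteSpectrum T (l : ℂ)) :
    transformedSpec T γ a b ⊆ spectrum ℂ (resolventOp T (γ : ℂ)) := by
  rintro _ ⟨l, ⟨hl, hls⟩, rfl⟩ hρ
  obtain ⟨x, hx, hx0⟩ := Submodule.exists_mem_ne_zero_of_ne_bot (hdis l hl hls).2.2.1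
  have hne : (l : ℂ) - γ ≠ 0 := by
    have := hl.1
    exact_mod_cast (show l - γ ≠ 0 by intro h; linarith)
  have he := (mem_eigenspaceU_iff hγ hne x).1 hx
  have h0 : (algebraMap ℂ (H →L[ℂ] H) ((1 / (l - γ) : ℝ) : ℂ) - resolventOp T (γ : ℂ)) x = 0 := by
    rw [sub_apply, he, Algebra.algebraMap_eq_smul_one]
    simp
  have := congrArg (fun S : H →L[ℂ] H => S x) (resolvent_mul_sub hρ)
  rw [mul_apply_eq_comp, h0, map_zero] at this
  exact hx0 this.symm

theorem eventually_eq_of_mem_transformedSpec (hγ : (γ : ℂ) ∈ resolventSetU T) (hγa : γ < a)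
    (hdis : ∀ l ∈ Set.Icc a b, (l : ℂ) ∈ spectrumU T → InDiscreteSpectrum T (l : ℂ)) :
    ∀ t ∈ transformedSpec T γ a b, ∀ᶠ w in 𝓝 t,
      w ∈ spectrum ℂ (resolventOp T (γ : ℂ)) → w = t := by
  rintro _ ⟨l, ⟨hl, hls⟩, rfl⟩
  obtain ⟨-, ⟨ε, hε, hiso⟩, -⟩ := hdis l hl hls
  have hlγ : 0 < l - γ := by have := hl.1; linarith
  have hne : ((1 / (l - γ) : ℝ) : ℂ) ≠ 0 := by exact_mod_cast (one_div_pos.2 hlγ).ne'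
  have hcont : ContinuousAt (fun w : ℂ => (γ : ℂ) + w⁻¹) ((1 / (l - γ) : ℝ) : ℂ) :=
    continuousAt_const.add (continuousAt_id.inv₀ hne)
  have hval : (γ : ℂ) + (((1 / (l - γ) : ℝ) : ℂ))⁻¹ = l := by push_cast; simp
  have hev := hcont.eventually (Metric.ball_mem_nhds _ hε)
  filter_upwards [hev, eventually_ne_nhds hne] with w hw hw0 hws
  rw [hval, dist_eq_norm] at hw
  have h := hiso _ (add_inv_mem_spectrumU hγ hw0 hws) hw
  rw [← hval, add_right_inj, inv_inj] at h
  exact h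

variable [CompleteSpace H]

theorem finite_transformedSpec (hT : IsSelfAdjoint T) (hγ : (γ : ℂ) ∈ resolventSetU T)
    (hγa : γ < a) (hab : a < b)
    (hdis : ∀ l ∈ Set.Icc a b, (l : ℂ) ∈ spectrumU T → InDiscreteSpectrum T (l : ℂ)) :
    (transformedSpec T γ a b).Finite := by
  by_contra hinf
  set σ := spectrum ℂ (resolventOp T (γ : ℂ))
  have hA := isSelfAdjoint_resolventOp hT hγ
  have hK : IsCompact (σ ∩ Complex.re ⁻¹' Set.Icc (1 / (b - γ)) (1 / (a - γ))) :=
    (spectrum.isCompact _).inter_right (isClosed_Icc.preimage Complex.continuous_re)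
  have hsK : transformedSpec T γ a b ⊆ σ ∩ Complex.re ⁻¹' Set.Icc (1 / (b - γ)) (1 / (a - γ)) := by
    intro t ht
    refine ⟨transformedSpec_subset_spectrum hγ hγa hdis ht, ?_⟩
    obtain ⟨l, ⟨hl, -⟩, rfl⟩ := ht
    rw [Set.mem_preimage, Complex.ofReal_re]
    have h1 := hl.1
    have h2 := hl.2
    exact ⟨one_div_le_one_div_of_le (by linarith) (by linarith),
      one_div_le_one_div_of_le (by linarith) (by linarith)⟩
  obtain ⟨t, htK, hacc⟩ := Set.Infinite.exists_accPt_of_subset_isCompact hinf hK hsK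
  have hts : t ∈ transformedSpec T γ a b := by
    have hre : t = (t.re : ℂ) := hA.mem_spectrum_eq_re htK.1
    rw [hre]
    exact mem_transformedSpec hγ hγa hab htK.2 (hre ▸ htK.1)
  rw [accPt_iff_frequently] at hacc
  refine hacc ?_
  filter_upwards [eventually_eq_of_mem_transformedSpec hγ hγa hdis t hts] with w hw hw'
  exact hw'.1 (hw (hsK hw'.2).1)

/-- The spectrum of `(T - γ)⁻¹` off `transformedSpec` has a positive distance from the transformed
interval, since the end points of the interval belong to the resolvent set. -/
theorem exists_gap_transformedSpec (hT : IsSelfAdjoint T) (hγ : (γ : ℂ) ∈ resolventSetU T)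
    (hγa : γ < a) (hab : a < b)
    (ha : (a : ℂ) ∈ resolventSetU T) (hb : (b : ℂ) ∈ resolventSetU T)
    (hdis : ∀ l ∈ Set.Icc a b, (l : ℂ) ∈ spectrumU T → InDiscreteSpectrum T (l : ℂ)) :
    ∃ η : ℝ, 0 < η ∧
      (∀ t ∈ spectrum ℂ (resolventOp T (γ : ℂ)), t ∉ transformedSpec T γ a b →
        ∃ x : ℝ, t = x ∧ (x ≤ 1 / (b - γ) - η ∨ 1 / (a - γ) + η ≤ x)) ∧
      ∀ l ∈ Set.Icc a b, (l : ℂ) ∈ spectrumU T →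
        1 / (b - γ) + η ≤ 1 / (l - γ) ∧ 1 / (l - γ) + η ≤ 1 / (a - γ) := by
  have hA := isSelfAdjoint_resolventOp hT hγ
  have hend : ∀ c : ℝ, γ < c → (c : ℂ) ∈ resolventSetU T → ∃ η : ℝ, 0 < η ∧ ∀ x : ℝ,
      (x : ℂ) ∈ spectrum ℂ (resolventOp T (γ : ℂ)) → η ≤ |x - 1 / (c - γ)| := by
    intro c hc hcρ
    have hmem : ((1 / (c - γ) : ℝ) : ℂ) ∈ resolventSet ℂ (resolventOp T (γ : ℂ)) := by
      refine mem_resolventSet_resolventOp hγ ?_ ?_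
      · exact_mod_cast (one_div_pos.2 (sub_pos.2 hc)).ne'
      · push_cast; simpa using hcρ
    obtain ⟨η, hη, hball⟩ := Metric.isOpen_iff.1 (spectrum.isOpen_resolventSet _) _ hmem
    refine ⟨η, hη, fun x hx => ?_⟩
    by_contra hlt
    rw [not_le] at hlt
    refine hx (hball ?_)
    rw [mem_ball_iff_norm, ← Complex.ofReal_sub, Complex.norm_real]
    exact hlt
  obtain ⟨η₁, hη₁, h₁⟩ := hend a hγa ha
  obtain ⟨η₂, hη₂, h₂⟩ := hend b (by linarith) hb
  refine ⟨min η₁ η₂, lt_min hη₁ hη₂, fun t ht hts => ?_, fun l hl hls => ?_⟩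
  · have hre : t = (t.re : ℂ) := hA.mem_spectrum_eq_re ht
    rw [hre] at ht hts
    refine ⟨t.re, hre, ?_⟩
    have ha' := (min_le_left η₁ η₂).trans (h₁ _ ht)
    have hb' := (min_le_right η₁ η₂).trans (h₂ _ ht)
    by_cases h1 : t.re < 1 / (b - γ)
    · rw [abs_of_neg (by linarith)] at hb'
      left; linarith
    · by_cases h2 : 1 / (a - γ) < t.re
      · rw [abs_of_pos (by linarith)] at ha'
        right; linarith
      · exact absurd (mem_transformedSpec hγ hγa hab ⟨not_lt.1 h1, not_lt.1 h2⟩ ht) hts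
  · have hmem := transformedSpec_subset_spectrum hγ hγa hdis ⟨l, ⟨hl, hls⟩, rfl⟩
    have ha' := (min_le_left η₁ η₂).trans (h₁ _ hmem)
    have hb' := (min_le_right η₁ η₂).trans (h₂ _ hmem)
    have h1 := hl.1
    have h2 := hl.2
    have h3 : 1 / (b - γ) ≤ 1 / (l - γ) := one_div_le_one_div_of_le (by linarith) (by linarith)
    have h4 : 1 / (l - γ) ≤ 1 / (a - γ) := one_div_le_one_div_of_le (by linarith) (by linarith)
    rw [abs_of_nonpos (by linarith)] at ha'
    rw [abs_of_nonneg (by linarith)] at hb'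
    constructor <;> linarith

theorem finiteDimensional_eigenspaceIcc (hT : IsSelfAdjoint T) (hγ : (γ : ℂ) ∈ resolventSetU T)
    (hγa : γ < a) (hab : a < b)
    (hdis : ∀ l ∈ Set.Icc a b, (l : ℂ) ∈ spectrumU T → InDiscreteSpectrum T (l : ℂ)) :
    FiniteDimensional ℂ (eigenspaceIcc T a b) := by
  have hfin : {l : ℝ | l ∈ Set.Icc a b ∧ (l : ℂ) ∈ spectrumU T}.Finite := by
    refine Set.Finite.of_finite_image (finite_transformedSpec hT hγ hγa hab hdis) ?_
    intro l hl l' hl' h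
    have h' : l - γ = l' - γ := by simpa using h
    linarith
  have : Finite {l : ℝ | l ∈ Set.Icc a b ∧ (l : ℂ) ∈ spectrumU T} := hfin
  have : ∀ l : {l : ℝ | l ∈ Set.Icc a b ∧ (l : ℂ) ∈ spectrumU T},
      FiniteDimensional ℂ (eigenspaceU T ((l : ℝ) : ℂ)) := fun l => (hdis l l.2.1 l.2.2).2.2.2
  refine Submodule.finiteDimensional_of_le
    (S₂ := ⨆ l : {l : ℝ | l ∈ Set.Icc a b ∧ (l : ℂ) ∈ spectrumU T}, eigenspaceU T ((l : ℝ) : ℂ)) ?_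
  refine iSup₂_le fun l hl => ?_
  by_cases hls : (l : ℂ) ∈ spectrumU T
  · exact le_iSup (fun l : {l : ℝ | l ∈ Set.Icc a b ∧ (l : ℂ) ∈ spectrumU T} =>
      eigenspaceU T ((l : ℝ) : ℂ)) ⟨l, hl, hls⟩
  · rw [eigenspaceU_eq_bot (not_not.1 hls)]; exact bot_le

/-- The projections onto the transformed Galerkin eigenvectors approximate the spectral projection
at the rate of the gap. -/
theorem exists_norm_one_sub_galerkinProj_mul_le (hT : IsSelfAdjoint T) {m : ℝ}
    (hm : ∀ l : ℝ, l < m → (l : ℂ) ∈ resolventSetU T) (hγ : γ < m)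
    (hγa : γ < a) (hab : a < b)
    (ha : (a : ℂ) ∈ resolventSetU T) (hb : (b : ℂ) ∈ resolventSetU T)
    (hdis : ∀ l ∈ Set.Icc a b, (l : ℂ) ∈ spectrumU T → InDiscreteSpectrum T (l : ℂ)) :
    ∃ C : ℝ, 0 ≤ C ∧ ∀ (L : Submodule ℂ H) [FiniteDimensional ℂ L], L ≤ formDomain T m →
      ‖(1 - galerkinProj T m γ a b L) *
          specProj (resolventOp T (γ : ℂ)) (transformedSpec T γ a b)‖
        ≤ C * formGap T m (eigenspaceIcc T a b) L := by
  have hγρ := hm γ hγ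
  have hA := isSelfAdjoint_resolventOp hT hγρ
  have hs := finite_transformedSpec hT hγρ hγa hab hdis
  have hiso := eventually_eq_of_mem_transformedSpec hγρ hγa hdis
  obtain ⟨η, hη, -, hηl⟩ := exists_gap_transformedSpec hT hγρ hγa hab ha hb hdis
  obtain ⟨C, hC, hCL⟩ := exists_norm_sub_starProjection_le hT hm hγ (eigenspaceIcc T a b)
  set A := resolventOp T (γ : ℂ) with hAdef
  set R := sqrtResolvent T γ with hR
  have hRR : R * R = A := sqrtResolvent_mul_self hT hm hγ
  have hRinj : Function.Injective R := sqrtResolvent_injective hT hm hγ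
  refine ⟨hs.toFinset.card * ((1 + ‖A‖ / η) * C), by positivity, fun L _ hL => ?_⟩
  have := finiteDimensional_comap hRinj L
  set δ := formGap T m (eigenspaceIcc T a b) L with hδ
  have hδ0 : 0 ≤ δ := formGap_nonneg _ _
  rw [specProj_eq_sum hs hiso, Finset.mul_sum]
  refine (norm_sum_le _ _).trans ?_
  rw [mul_assoc, ← nsmul_eq_mul]
  refine Finset.sum_le_card_nsmul _ _ _ fun t ht => ?_
  rw [Set.Finite.mem_toFinset] at ht
  have hiso_t := hiso t ht
  obtain ⟨l, ⟨hl, hls⟩, rfl⟩ := ht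
  refine ContinuousLinearMap.opNorm_le_bound _ (by positivity) fun x => ?_
  set e := specProj A {((1 / (l - γ) : ℝ) : ℂ)} x with he
  have hAe : A e = ((1 / (l - γ) : ℝ) : ℂ) • e :=
    (range_specProj_singleton hA.isStarNormal hiso_t e).1 ⟨x, rfl⟩
  have hen : ‖e‖ ≤ ‖x‖ := ((specProj A _).le_opNorm x).trans
    (mul_le_of_le_one_left (norm_nonneg _) (norm_specProj_le _ _))
  have hne : (l : ℂ) - γ ≠ 0 := by
    have := hl.1
    exact_mod_cast (show l - γ ≠ 0 by intro h; linarith)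
  have hRe : R e ∈ eigenspaceIcc T a b := by
    refine le_iSup₂ (f := fun (l : ℝ) (_ : l ∈ Set.Icc a b) => eigenspaceU T (l : ℂ)) l hl ?_
    rw [mem_eigenspaceU_iff hγρ hne, ← hAdef]
    have : A (R e) = R (A e) := by rw [← hRR]; rfl
    rw [this, hAe, map_smul]
    congr 1; push_cast; rw [one_div]
  obtain ⟨hp, hq⟩ := hηl l hl hls
  have h1 := norm_sub_starProjection_le_of_eigenvector hA (L.comap R.toLinearMap)
    (transformedSpan T m γ a b L) hη hp hq
    (fun u hu ν hν h => mem_transformedSpan hT hm hγ hγa L hL hu hν hab h) hAe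
  calc ‖((1 - galerkinProj T m γ a b L) * specProj A {((1 / (l - γ) : ℝ) : ℂ)}) x‖
      = ‖e - (transformedSpan T m γ a b L).starProjection e‖ := rfl
    _ ≤ (1 + ‖A‖ / η) * (C * δ * ‖e‖) := h1.trans (by
        gcongr
        exact hCL L e hRe)
    _ ≤ (1 + ‖A‖ / η) * (C * δ * ‖x‖) := by gcongr
    _ = _ := by ring

end

end Galerkin

namespace Galerkin

/-! ### Distances in the complex plane -/

/-- A point outside the unit circle around `p` has distance greater than one from the points beyond
`p`: it gains `η²` by Pythagoras. -/
theorem sqrt_one_add_sq_le_norm_sub_of_le {p x η : ℝ} {z : ℂ} (hη : 0 ≤ η) (h : p ≤ z.re)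
    (h1 : 1 ≤ ‖z - (p : ℂ)‖) (hx : x ≤ p - η) : √(1 + η ^ 2) ≤ ‖z - (x : ℂ)‖ := by
  have e : ∀ y : ℝ, ‖z - (y : ℂ)‖ ^ 2 = (z.re - y) ^ 2 + z.im ^ 2 := fun y => by
    rw [Complex.sq_norm, Complex.normSq_apply]; simp; ring
  refine Real.sqrt_le_iff.2 ⟨norm_nonneg _, ?_⟩
  have h2 : 1 ≤ (z.re - p) ^ 2 + z.im ^ 2 := by rw [← e]; exact one_le_pow₀ h1
  rw [e]
  nlinarith

theorem sqrt_one_add_sq_le_norm_sub_of_ge {q x η : ℝ} {z : ℂ} (hη : 0 ≤ η) (h : z.re ≤ q)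
    (h1 : 1 ≤ ‖z - (q : ℂ)‖) (hx : q + η ≤ x) : √(1 + η ^ 2) ≤ ‖z - (x : ℂ)‖ := by
  have h' := sqrt_one_add_sq_le_norm_sub_of_le (p := -q) (x := -x) (z := -z) hη (by simpa using h)
    (by rw [Complex.ofReal_neg, ← neg_sub', norm_neg]; exact h1) (by linarith)
  rwa [Complex.ofReal_neg, ← neg_sub', norm_neg] at h'

/-- All sufficiently small radii keep the circles around the points of a finite set apart. -/
theorem eventually_two_mul_le_norm_sub {s : Set ℂ} (hs : s.Finite) :
    ∀ᶠ r in 𝓝[>] (0 : ℝ), ∀ t ∈ s, ∀ t' ∈ s, t ≠ t' → 2 * r ≤ ‖t - t'‖ := by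
  rw [eventually_all_finite hs]
  intro t _
  rw [eventually_all_finite hs]
  intro t' _
  by_cases h : t = t'
  · exact Eventually.of_forall fun _ hne => absurd h hne
  · have hpos : 0 < ‖t - t'‖ / 2 := by have := norm_pos_iff.2 (sub_ne_zero.2 h); linarith
    filter_upwards [Ioo_mem_nhdsGT hpos] with r hr _
    have := hr.2
    linarith

end Galerkin

theorem corollary3p7 {H : Type*} [NormedAddCommGroup H] [InnerProductSpace ℂ H] [CompleteSpace H]
    -- a self-adjoint operator, bounded from below and unbounded from above, with `m = min σ(T)`
    (T : H →ₗ.[ℂ] H) (hT : IsSelfAdjoint T)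
    (hbelow : Galerkin.BoundedFromBelow T) (habove : ¬ Galerkin.BoundedFromAbove T)
    (m : ℝ) (hm : IsLeast {l : ℝ | (l : ℂ) ∈ Galerkin.spectrumU T} m)
    -- finite-dimensional trial spaces, dense in the form domain
    (L : ℕ → Submodule ℂ H) [∀ n, FiniteDimensional ℂ (L n)]
    (hL : ∀ n, L n ≤ Galerkin.formDomain T m)
    (hdense : ∀ x : Galerkin.formDomain T m, ∃ y : ℕ → Galerkin.formDomain T m,
      (∀ n, (y n : H) ∈ L n) ∧ Tendsto (fun n => Galerkin.formNorm T m (x - y n)) atTop (𝓝 0))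
    -- the interval `Δ = [a, b]`
    (a b : ℝ) (hab : a < b)
    (ha : (a : ℂ) ∈ Galerkin.resolventSetU T) (hb : (b : ℂ) ∈ Galerkin.resolventSetU T)
    (hdis : ∀ l ∈ Set.Icc a b, (l : ℂ) ∈ Galerkin.spectrumU T →
      Galerkin.InDiscreteSpectrum T (l : ℂ))
    -- the shift
    (γ : ℝ) (hγ : γ < m) (hγa : γ < a) :
    ∃ τ r : ℕ → ℝ, (∀ n, 0 ≤ τ n) ∧ (∀ n, 0 ≤ r n) ∧
      τ =O[atTop] (fun n => Galerkin.formGap T m (Galerkin.eigenspaceIcc T a b) (L n)) ∧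
      r =O[atTop] (fun n => Galerkin.formGap T m (Galerkin.eigenspaceIcc T a b) (L n) ^ 2) ∧
      ∀ᶠ n in atTop,
        (Galerkin.regionU (1 / (b - γ)) (1 / (a - γ)) (τ n) (r n)
            {x : ℝ | ∃ l ∈ Set.Icc a b, (l : ℂ) ∈ Galerkin.spectrumU T ∧ x = 1 / (l - γ)}
            \ {z : ℂ | z.im = 0} ⊆
          resolventSet ℂ (Galerkin.resolventOp T (γ : ℂ)
            + Complex.I • Galerkin.galerkinProj T m γ a b (L n))) ∧
        ∀ l ∈ Set.Icc a b, (l : ℂ) ∈ Galerkin.spectrumU T →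
          -- the circle of radius `r n`, if the gap is positive
          (Galerkin.formGap T m (Galerkin.eigenspaceIcc T a b) (L n) ≠ 0 →
            0 < r n ∧
            Galerkin.CircleEncloses (Galerkin.resolventOp T (γ : ℂ)
                + Complex.I • Galerkin.galerkinProj T m γ a b (L n))
              (((1 / (l - γ) : ℝ) : ℂ) + Complex.I) (r n) (Galerkin.eigenspaceU T (l : ℂ))) ∧
          -- all small circles, if the gap vanishes (and the radius is forced to be zero)
          (Galerkin.formGap T m (Galerkin.eigenspaceIcc T a b) (L n) = 0 →
            ∀ᶠ s in 𝓝[>] (0 : ℝ),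
              Galerkin.CircleEncloses (Galerkin.resolventOp T (γ : ℂ)
                  + Complex.I • Galerkin.galerkinProj T m γ a b (L n))
                (((1 / (l - γ) : ℝ) : ℂ) + Complex.I) s (Galerkin.eigenspaceU T (l : ℂ))) := by
  open Galerkin in
  have hm' : ∀ l : ℝ, l < m → (l : ℂ) ∈ resolventSetU T := fun l hl => by
    by_contra h
    exact absurd (hm.2 (show l ∈ {l : ℝ | (l : ℂ) ∈ spectrumU T} from h)) (not_le.2 hl)
  have hγρ := hm' γ hγ
  have hA := (isSelfAdjoint_resolventOp hT hγρ).isStarNormal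
  have hs := finite_transformedSpec hT hγρ hγa hab hdis
  have hiso := eventually_eq_of_mem_transformedSpec hγρ hγa hdis
  obtain ⟨η, hη, hηout, hηin⟩ := exists_gap_transformedSpec hT hγρ hγa hab ha hb hdis
  obtain ⟨C, hC, hCL⟩ := exists_norm_one_sub_galerkinProj_mul_le hT hm' hγ hγa hab ha hb hdis
  have hNfin := finiteDimensional_eigenspaceIcc hT hγρ hγa hab hdis
  have hδlim := tendsto_formGap hT hm' (eigenspaceIcc T a b) L hdense
  set A := resolventOp T (γ : ℂ)
  set s := transformedSpec T γ a b with hsdef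
  set δ : ℕ → ℝ := fun n => formGap T m (eigenspaceIcc T a b) (L n) with hδdef
  have hδ0 : ∀ n, 0 ≤ δ n := fun n => formGap_nonneg _ _
  set Q : ℕ → H →L[ℂ] H := fun n => galerkinProj T m γ a b (L n) with hQdef
  have hQ : ∀ n, IsStarProjection (Q n) := fun n => isStarProjection_starProjection
  have hQ1 : ∀ n, ‖Q n‖ ≤ 1 := fun n => Submodule.starProjection_norm_le _
  have hQε : ∀ n, ‖(1 - Q n) * specProj A s‖ ≤ C * δ n := fun n => hCL (L n) (hL n)
  -- points of the region have distance at least `√(1 + η²) = 2 κ - 1 > κ` from the rest of `σ(A)`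
  obtain ⟨κ, hκ, hκη⟩ : ∃ κ : ℝ, 1 < κ ∧ √(1 + η ^ 2) = 2 * κ - 1 := by
    refine ⟨(1 + √(1 + η ^ 2)) / 2, ?_, by ring⟩
    have : 1 < √(1 + η ^ 2) := by
      rw [Real.lt_sqrt zero_le_one]; nlinarith
    linarith
  have hfar : ∀ z : ℂ, 1 / (b - γ) ≤ z.re → z.re ≤ 1 / (a - γ) →
      1 ≤ ‖z - ((1 / (b - γ) : ℝ) : ℂ)‖ → 1 ≤ ‖z - ((1 / (a - γ) : ℝ) : ℂ)‖ →
      ∀ t ∈ spectrum ℂ A, t ∉ s → 2 * κ - 1 ≤ ‖z - t‖ := by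
    intro z h1 h2 h3 h4 t ht hts
    obtain ⟨x, rfl, hx | hx⟩ := hηout t ht hts
    · rw [← hκη]; exact sqrt_one_add_sq_le_norm_sub_of_le hη.le h1 h3 hx
    · rw [← hκη]; exact sqrt_one_add_sq_le_norm_sub_of_ge hη.le h2 h4 hx
  obtain ⟨c, hc0, hc⟩ : ∃ c : ℝ, 0 < c ∧ c ^ 2 + (κ - 1)⁻¹ * c + c ≤ 1 / 4 := by
    have hM : 0 < (κ - 1)⁻¹ := inv_pos.2 (by linarith)
    refine ⟨1 / (4 * ((κ - 1)⁻¹ + 2)), by positivity, ?_⟩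
    set M := (κ - 1)⁻¹
    have h1 : 1 / (4 * (M + 2)) ≤ 1 := by
      rw [div_le_one (by positivity)]; linarith
    have h2 : 1 / (4 * (M + 2)) * (M + 2) = 1 / 4 := by field_simp
    have h3 : 0 < 1 / (4 * (M + 2)) := by positivity
    nlinarith
  have hgood : ∀ᶠ r in 𝓝[>] (0 : ℝ), 0 < r ∧ r < 1 ∧ r ≤ κ - 1 ∧
      ∀ t ∈ s, ∀ t' ∈ s, t ≠ t' → 2 * r ≤ ‖t - t'‖ := by
    filter_upwards [eventually_two_mul_le_norm_sub hs,
      Ioo_mem_nhdsGT (show (0 : ℝ) < min 1 (κ - 1) from lt_min one_pos (by linarith))]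
      with r hr hr'
    exact ⟨hr'.1, hr'.2.trans_le (min_le_left _ _), (hr'.2.trans_le (min_le_right _ _)).le, hr⟩
  have hcircle : ∀ n (r : ℝ), (0 < r ∧ r < 1 ∧ r ≤ κ - 1 ∧
      ∀ t ∈ s, ∀ t' ∈ s, t ≠ t' → 2 * r ≤ ‖t - t'‖) → C * δ n ≤ c * √r →
      ∀ l ∈ Set.Icc a b, (l : ℂ) ∈ spectrumU T →
        CircleEncloses (A + Complex.I • Q n) (((1 / (l - γ) : ℝ) : ℂ) + Complex.I) r
          (eigenspaceU T (l : ℂ)) := by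
    rintro n r ⟨hr0, hr1, hrκ, hsep⟩ hε l hl hls
    have hμ : ((1 / (l - γ) : ℝ) : ℂ) ∈ s := ⟨l, ⟨hl, hls⟩, rfl⟩
    have hne : (l : ℂ) - γ ≠ 0 := by
      have := hl.1
      exact_mod_cast (show l - γ ≠ 0 by intro h; linarith)
    have hrange : LinearMap.range (specProj A {((1 / (l - γ) : ℝ) : ℂ)}).toLinearMap
        = eigenspaceU T (l : ℂ) := by
      ext x
      rw [range_specProj_singleton hA (hiso _ hμ), mem_eigenspaceU_iff hγρ hne]
      push_cast
      rw [one_div]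
    rw [← hrange]
    refine circleEncloses_add_I_smul hA hs hiso (hQ n) (hQ1 n) hκ hr0 hc
      (mul_nonneg hC (hδ0 n)) (hQε n) hε hμ hr1 hrκ (fun z hz t ht hts => ?_)
      (fun t ht htμ => hsep t ht _ hμ htμ)
    obtain ⟨h1, h2⟩ := hηin l hl hls
    have him : ∀ x : ℝ, 1 ≤ ‖((1 / (l - γ) : ℝ) : ℂ) + Complex.I - (x : ℂ)‖ := fun x => by
      refine le_trans ?_ (Complex.abs_im_le_norm _)
      simp
    have hre : (((1 / (l - γ) : ℝ) : ℂ) + Complex.I).re = 1 / (l - γ) := by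
      rw [Complex.add_re, Complex.ofReal_re, Complex.I_re, add_zero]
    have h3 := hfar (((1 / (l - γ) : ℝ) : ℂ) + Complex.I) (by rw [hre]; linarith)
      (by rw [hre]; linarith) (him _) (him _) t ht hts
    rw [mem_closedBall_iff_norm] at hz
    have h4 : ‖((1 / (l - γ) : ℝ) : ℂ) + Complex.I - t‖
        ≤ ‖z - (((1 / (l - γ) : ℝ) : ℂ) + Complex.I)‖ + ‖z - t‖ := by
      rw [show ((1 / (l - γ) : ℝ) : ℂ) + Complex.I - t
        = (z - t) - (z - (((1 / (l - γ) : ℝ) : ℂ) + Complex.I)) by ring]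
      exact (norm_sub_le _ _).trans_eq (add_comm _ _)
    linarith
  -- the smallest radius, up to a constant, that is admissible for the error `C δ`
  set ρ : ℕ → ℝ := fun n => ((C + 1) / c * δ n) ^ 2 with hρdef
  have hρε : ∀ n, C * δ n ≤ c * √(ρ n) := fun n => by
    have h1 : 0 ≤ (C + 1) / c * δ n := mul_nonneg (by positivity) (hδ0 n)
    rw [hρdef, Real.sqrt_sq h1]
    calc C * δ n ≤ (C + 1) * δ n := mul_le_mul_of_nonneg_right (by linarith) (hδ0 n)
      _ = c * ((C + 1) / c * δ n) := by field_simp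
  have hρ0 : Tendsto ρ atTop (𝓝 0) := by
    simpa using (hδlim.const_mul ((C + 1) / c)).pow 2
  refine ⟨fun _ => 0, ρ, fun _ => le_rfl, fun n => sq_nonneg _, isBigO_zero _ _, ?_, ?_⟩
  · simp only [hρdef, mul_pow]
    exact (isBigO_refl (fun n => δ n ^ 2) atTop).const_mul_left _
  rw [eventually_nhdsWithin_iff] at hgood
  filter_upwards [hρ0.eventually hgood] with n hn
  refine ⟨?_, fun l hl hls => ⟨fun hδn => ?_, fun hδn => ?_⟩⟩
  · rintro z ⟨⟨h1, h2, -, -, h3, h4, h5⟩, -⟩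
    rw [add_zero] at h3 h4
    have hz : ∀ t ∈ spectrum ℂ A, t ∉ s → κ ≤ ‖z - t‖ := fun t ht hts => by
      have := hfar z h1 h2 h3 h4 t ht hts
      linarith
    have h5' : ∀ t ∈ s, ρ n ≤ ‖z - (t + Complex.I)‖ ∧ z ≠ t + Complex.I := by
      rintro _ ⟨l, ⟨hl, hls⟩, rfl⟩
      exact h5 _ ⟨l, hl, hls, rfl⟩
    obtain ⟨r, hr0, hrε, hr⟩ : ∃ r : ℝ, 0 < r ∧ C * δ n ≤ c * √r ∧
        ∀ t ∈ s, r ≤ ‖z - (t + Complex.I)‖ := by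
      rcases (hδ0 n).eq_or_lt with h0 | h0
      · have hev : ∀ᶠ r in 𝓝[>] (0 : ℝ), ∀ t ∈ s, r ≤ ‖z - (t + Complex.I)‖ := by
          rw [eventually_all_finite hs]
          intro t ht
          filter_upwards [Ioo_mem_nhdsGT (norm_pos_iff.2 (sub_ne_zero.2 (h5' t ht).2))] with r hr
          exact hr.2.le
        obtain ⟨r, hr, hr0⟩ := (hev.and self_mem_nhdsWithin).exists
        exact ⟨r, hr0, by rw [← h0, mul_zero]; positivity, hr⟩
      · exact ⟨ρ n, by positivity, hρε n, fun t ht => (h5' t ht).1⟩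
    exact mem_resolventSet_add_I_smul hA hs hiso (hQ n) (hQ1 n) hκ hr0 hc
      (mul_nonneg hC (hδ0 n)) (hQε n) hrε hz hr
  · have h0 : 0 < δ n := lt_of_le_of_ne (hδ0 n) (Ne.symm hδn)
    have hρn : 0 < ρ n := by positivity
    exact ⟨hρn, hcircle n (ρ n) (hn hρn) (hρε n) l hl hls⟩
  · rw [← eventually_nhdsWithin_iff] at hgood
    filter_upwards [hgood, self_mem_nhdsWithin] with r hr _
    refine hcircle n r hr ?_ l hl hls
    have : δ n = 0 := hδn
    rw [this, mul_zero]; positivity
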